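/- Let $n\ge 1$ be an integer, $S\subseteq\mathbb{Z}^2$ a finite set and $f:S\to\mathbb{C}$ a function. An *$S$-triangle* with $n$ rows is an array of integers $(a_{i,j})_{1\le i\le j\le n}$, where $(a_{1,1},\dots,a_{1,n})$ is the bottom row and $a_{i+1,j+1}$ is placed above and between $a_{i,j}$ and $a_{i,j+1}$, together with a set of marked *special entries* among the inner entries $a_{i,j}$, $1\le i<j<n$, no two of which are adjacent in a row, such that: 1. if $a_{i,j}$ is special, then for its *parents* $a_{i+1,j},a_{i+1,j+1}$ there is $s=(r,t)\in S$ with $(a_{i+1,j},a_{i+1,j+1})=(a_{i,j}+r,a_{i,j}+t)$; we say that $a_{i,j}$ is associated to $s$; 2. if $i\ge 2$ and $a_{i,j}$ is not a parent of a special entry, then $a_{i-1,j-1}\le a_{i,j}\le a_{i-1,j}$ in case $a_{i-1,j-1}\le a_{i-1,j}$, and $a_{i-1,j-1}>a_{i,j}>a_{i-1,j}$ in case $a_{i-1,j-1}>a_{i-1,j}$; in the latter case the pair $(a_{i-1,j-1},a_{i-1,j})$ is called an *inversion*. The *weight* of an $S$-triangle is $(-1)^{\#\text{inversions}}\prod_{s\in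 S}f(s)^{\#\text{special entries associated to }s}$. For $k=(k_1,\dots,k_n)\in\mathbb{Z}^n$ let $W_{S,f}(k)$ be the sum of the weights of all $S$-triangles with bottom row $k$. For $k\in\mathbb{Z}^n$ and a function $A$ on $\mathbb{Z}^{n-1}$ define the summation operator recursively by $$\sum_{(l_1,\dots,l_{n-1})}^{(k_1,\dots,k_n)}A(l_1,\dots,l_{n-1})=\sum_{l_{n-1}=k_{n-1}}^{k_n}\ \sum_{(l_1,\dots,l_{n-2})}^{(k_1,\dots,k_{n-1})}A(l_1,\dots,l_{n-1})+\sum_{(l_1,\dots,l_{n-3})}^{(k_1,\dots,k_{n-2})}\ \sum_{(i,j)\in S}f(i,j)\,A(l_1,\dots,l_{n-3},k_{n-1}+i,k_{n-1}+j)$$ for $n\ge2$, where the operator is $A\mapsto A$ if the upper row has length $1$ and zero if it has length $0$, and $\sum_{x=a}^{b}g(x):=-\sum_{x=b+1}^{a-1}g(x)$ if $a>b$. Let $\alpha_{1,1}(1,0,S,f;k_1)=1$ and $\alpha_{1,1}(n,0,S,f;k_1,\dots,k_n)=\sum_{(l_1,\dots,l_{n-1})}^{(k_1,\dots,k_n)}\alpha_{1,1}(n-1,0,S,f;l_1,\dots,l_{n-1})$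 for $n\geq 2$. Finally, let $E_{k_t}$ be the shift operator $k_t\mapsto k_t+1$ on functions of $(k_1,\dots,k_n)\in\mathbb{Z}^n$. **Claim.** Every Laurent polynomial $s(X,Y)\in\mathbb{C}[X^{\pm1},Y^{\pm1}]$ can be written as $s(X,Y)=-\sum_{(i,j)\in S}f(i,j)\,Y^iX^j$ for some finite $S\subseteq\mathbb{Z}^2$ and $f:S\to\mathbb{C}$. For every such representation and every $k\in\mathbb{Z}^n$ (not necessarily increasing), there are only finitely many $S$-triangles with bottom row $k$, and with $r(X,Y)=Y+(X-1)(Y-1)s(X,Y)$ one has $$\prod_{1\le s<t\le n}r(E_{k_s},E_{k_t})\prod_{1\le i<j\le n}\frac{k_j-k_i}{j-i}=\alpha_{1,1}(n,0,S,f;k_1,\dots,k_n)=W_{S,f}(k).$$ In particular, for every $k\in\mathbb{Z}^n$, $$\prod_{1\le s<t\le n}\left(\operatorname{id}-E_{k_s}+E_{k_s}E_{k_t}\right)\prod_{1\le i<j\le n}\frac{k_j-k_i}{j-i}=W_{\{(0,0)\},-1}(k),$$ where $-1$ denotes the constant function with value $-1$. -/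

import Mathlib

noncomputable section

namespace OperatorFormula

/-! ### Laurent polynomials in two variables and shift operators -/

/-- Laurent polynomials over `ℂ` in `X, Y`: the exponent `(a, b)` stands for `X ^ a * Y ^ b`. -/
abbrev Laurent₂ : Type := AddMonoidAlgebra ℂ (ℤ × ℤ)

/-- The variable `X`. -/
def X : Laurent₂ := AddMonoidAlgebra.single (1, 0) 1

/-- The variable `Y`. -/
def Y : Laurent₂ := AddMonoidAlgebra.single (0, 1) 1

/-- `s(X, Y) = - ∑_{(i, j) ∈ S} f(i, j) Y ^ i X ^ j`. -/
def laurentOf (S : Finset (ℤ × ℤ)) (f : S → ℂ) : Laurent₂ :=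
  - ∑ p : S, AddMonoidAlgebra.single ((p : ℤ × ℤ).2, (p : ℤ × ℤ).1) (f p)

/-- The `i`-th power (`i ∈ ℤ`) of the shift operator `E_{k_t}`, which replaces `k_t` by `k_t + 1`,
acting on complex valued functions of `(k_1, …, k_n) ∈ ℤⁿ`. -/
def shiftPow {n : ℕ} (t : Fin n) (i : ℤ) : Module.End ℂ ((Fin n → ℤ) → ℂ) where
  toFun F := fun k => F (k + Pi.single t i)
  map_add' _ _ := rfl
  map_smul' _ _ := rfl

/-- The operator `r(E_{k_s}, E_{k_t})`. -/
def evalShift {n : ℕ} (r : Laurent₂) (s t : Fin n) : Module.End ℂ ((Fin n → ℤ) → ℂ) :=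
  r.coeff.sum fun p c => c • (shiftPow s p.1 * shiftPow t p.2)

theorem shiftPow_commute {n : ℕ} (s t : Fin n) (i j : ℤ) :
    Commute (shiftPow s i) (shiftPow t j) := by
  ext F k
  simp [shiftPow, add_right_comm]

theorem evalShift_commute {n : ℕ} (r : Laurent₂) (s t s' t' : Fin n) :
    Commute (evalShift r s t) (evalShift r s' t') := by
  unfold evalShift Finsupp.sum
  refine Commute.sum_left _ _ _ fun p _ => Commute.sum_right _ _ _ fun q _ => ?_
  refine Commute.smul_left (Commute.smul_right ?_ _) _
  exact ((shiftPow_commute _ _ _ _).mul_right (shiftPow_commute _ _ _ _)).mul_left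
    ((shiftPow_commute _ _ _ _).mul_right (shiftPow_commute _ _ _ _))

/-- The composition `∏_{s < t} r(E_{k_s}, E_{k_t})` of pairwise commuting operators. -/
def prodOperator (n : ℕ) (r : Laurent₂) : Module.End ℂ ((Fin n → ℤ) → ℂ) :=
  (Finset.univ.filter fun p : Fin n × Fin n => p.1 < p.2).noncommProd
    (fun p => evalShift r p.1 p.2) fun _ _ _ _ _ => evalShift_commute r _ _ _ _

/-- The function `∏_{i < j} (k_j - k_i) / (j - i)`. -/
def gtProduct (n : ℕ) (k : Fin n → ℤ) : ℂ :=
  ∏ p ∈ Finset.univ.filter (fun p : Fin n × Fin n => p.1 < p.2),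
    ((k p.2 : ℂ) - (k p.1 : ℂ)) / (((p.2 : ℕ) : ℂ) - ((p.1 : ℕ) : ℂ))

/-! ### The recursion defining `α_{1,1}(n, 0, S, f; k_1, …, k_n)` -/

/-- The sum `∑_{x=a}^{b} g(x)` over integers, which for `a > b` means `- ∑_{x=b+1}^{a-1} g(x)`. -/
def extSum (a b : ℤ) (g : ℤ → ℂ) : ℂ :=
  if a ≤ b then ∑ x ∈ Finset.Icc a b, g x else - ∑ x ∈ Finset.Icc (b + 1) (a - 1), g x

/-- The summation operator `∑_{(l_1, …, l_m)}^{(k_1, …, k_{m+1})} A(l_1, …, l_m)` associated to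
`(S, f)`. For a bottom row of length two the second summand of the recursion is absent,
since the summation operator over an empty upper row is zero. -/
def sumOp (S : Finset (ℤ × ℤ)) (f : S → ℂ) :
    (m : ℕ) → (Fin (m + 1) → ℤ) → ((Fin m → ℤ) → ℂ) → ℂ
  | 0, _, A => A Fin.elim0
  | 1, k, A => extSum (k 0) (k 1) fun l =>
      sumOp S f 0 (Fin.init k) fun l' => A (Fin.snoc (α := fun _ => ℤ) l' l)
  | m + 2, k, A =>
      let y : ℤ := Fin.init k (Fin.last (m + 1))
      let z : ℤ := k (Fin.last (m + 2))
      (extSum y z fun l =>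
        sumOp S f (m + 1) (Fin.init k) fun l' => A (Fin.snoc (α := fun _ => ℤ) l' l))
      + sumOp S f m (Fin.init (Fin.init k)) fun l' => ∑ p : S, f p *
          A (Fin.snoc (α := fun _ => ℤ)
            (Fin.snoc (α := fun _ => ℤ) l' (y + (p : ℤ × ℤ).1)) (y + (p : ℤ × ℤ).2))

/-- `α_{1,1}(n, 0, S, f; k_1, …, k_n)`; the value `1` for `n = 0` only serves to give the
initial value `1` for `n = 1`. -/
def alpha (S : Finset (ℤ × ℤ)) (f : S → ℂ) : (n : ℕ) → (Fin n → ℤ) → ℂ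
  | 0, _ => 1
  | m + 1, k => sumOp S f m k (alpha S f m)

/-! ### `S`-triangles -/

/-- The position `(i, j)` is a parent of one of the marked positions: the parents of `(i, j)` are
`(i + 1, j)` and `(i + 1, j + 1)`. -/
def IsParent (special : Finset (ℕ × ℕ)) (i j : ℕ) : Prop :=
  ∃ p ∈ special, (i, j) = (p.1 + 1, p.2) ∨ (i, j) = (p.1 + 1, p.2 + 1)

instance (special : Finset (ℕ × ℕ)) (i j : ℕ) : Decidable (IsParent special i j) := by
  unfold IsParent; infer_instance

/-- An `S`-triangle with `n` rows: integers `a_{i,j}`, `1 ≤ i ≤ j ≤ n`, together with a set of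
positions of special entries. The row `i = 1` is the bottom row, and `a_{i+1,j+1}` is placed above
and between `a_{i,j}` and `a_{i,j+1}`. Values of `entry` outside of the triangle are fixed to be
`0`, so that they carry no information. -/
@[ext]
structure STriangle (S : Finset (ℤ × ℤ)) (n : ℕ) where
  entry : ℕ → ℕ → ℤ
  entry_outside : ∀ i j, ¬ (1 ≤ i ∧ i ≤ j ∧ j ≤ n) → entry i j = 0
  special : Finset (ℕ × ℕ)
  special_inner : ∀ i j, (i, j) ∈ special → 1 ≤ i ∧ i < j ∧ j < n
  special_not_adjacent : ∀ i j, (i, j) ∈ special → (i, j + 1) ∉ special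
  special_parents : ∀ i j, (i, j) ∈ special →
    ∃ s ∈ S, (entry (i + 1) j, entry (i + 1) (j + 1)) = (entry i j + s.1, entry i j + s.2)
  between_of_le : ∀ i j, 1 ≤ i → i ≤ j → j < n → ¬ IsParent special (i + 1) (j + 1) →
    entry i j ≤ entry i (j + 1) →
      entry i j ≤ entry (i + 1) (j + 1) ∧ entry (i + 1) (j + 1) ≤ entry i (j + 1)
  between_of_gt : ∀ i j, 1 ≤ i → i ≤ j → j < n → ¬ IsParent special (i + 1) (j + 1) →
    entry i j > entry i (j + 1) →
      entry i j > entry (i + 1) (j + 1) ∧ entry (i + 1) (j + 1) > entry i (j + 1)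

namespace STriangle

variable {S : Finset (ℤ × ℤ)} {n : ℕ}

/-- The bottom row of the triangle is `(k_1, …, k_n)`. -/
def HasBottomRow (T : STriangle S n) (k : Fin n → ℤ) : Prop :=
  ∀ j : Fin n, T.entry 1 (j + 1) = k j

/-- The inversions, i.e. the pairs `(a_{i,j}, a_{i,j+1})` with `a_{i,j} > a_{i,j+1}` for which the
entry `a_{i+1,j+1}` above is not a parent of a special entry, recorded by the position `(i, j)`. -/
def inversions (T : STriangle S n) : Finset (ℕ × ℕ) :=
  (Finset.Icc 1 n ×ˢ Finset.Icc 1 n).filter fun p =>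
    p.1 ≤ p.2 ∧ p.2 < n ∧ ¬ IsParent T.special (p.1 + 1) (p.2 + 1) ∧
      T.entry p.1 p.2 > T.entry p.1 (p.2 + 1)

/-- The special entries associated to `s`. -/
def specialAssoc (T : STriangle S n) (s : ℤ × ℤ) : Finset (ℕ × ℕ) :=
  T.special.filter fun p =>
    (T.entry (p.1 + 1) p.2, T.entry (p.1 + 1) (p.2 + 1)) =
      (T.entry p.1 p.2 + s.1, T.entry p.1 p.2 + s.2)

/-- The weight `(-1)^{# inversions} ∏_{s ∈ S} f(s)^{# special entries associated to s}`. -/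
def weight (f : S → ℂ) (T : STriangle S n) : ℂ :=
  (-1) ^ T.inversions.card * ∏ s : S, f s ^ (T.specialAssoc s).card

end STriangle

/-- The sum of the weights of all `S`-triangles with bottom row `(k_1, …, k_n)`. -/
def weightedCount (S : Finset (ℤ × ℤ)) (f : S → ℂ) (n : ℕ) (k : Fin n → ℤ) : ℂ :=
  ∑ᶠ T ∈ {T : STriangle S n | T.HasBottomRow k}, T.weight f

end OperatorFormula

end

/-!
The Laurent polynomials in the shift operators form the group algebra of `ℤⁿ`, which acts on
functions on `ℤⁿ`. Let `D_c(k) = det (binom (k_i, j + c))`, so that `D_0` is the product of the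
`(k_j - k_i) / (j - i)` and `D_0 = Δ D_1` for the mixed difference `Δ = ∏ (E_i - 1)`.

Since `D_1` is antisymmetric and `r(E_{i+1}, E_i) ∏_{s < t} r(E_s, E_t)` is invariant under
exchanging `i` and `i + 1`, the function `B = ∏_{s < t} r(E_s, E_t) D_1` has the property that
`r(E_{i+1}, E_i) B` vanishes where `k_i = k_{i+1}`. This is exactly what makes the sum over `S` in
the recursion of the summation operator cancel the superfluous terms of the telescoping sums, so
that applying the operator to `Δ B` gives
`∑_{p = 0}^n (-1)^p B(k_0, …, k_{p-1}, k_{p+1} + 1, …, k_n + 1)`. On functions independent of `k_p`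
the operator `E_p` acts as the identity, and `r(1, Y) = Y`, `r(X, 1) = 1`; hence this sum is the
image under the product `∏_{s < t} r(E_s, E_t)` in `n + 1` variables of the Laplace expansion of
`D_0` along its first column, which yields the first equality by induction on `n`.

For the second equality, the summation operator is a weighted sum over the rows which may be placed
above a given row together with its special entries, and removing the bottom row of a triangle
turns `W_{S,f}` into the same recursion.
-/

noncomputable section

namespace OperatorFormula

section ShiftAction

variable {R G M : Type*} [CommSemiring R] [AddCommMonoid G] [AddCommMonoid M] [Module R M]

/-- The action of the monoid algebra of `G` on functions on `G`, in which `v : G` acts as the shift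
operator `F ↦ F (· + v)`. -/
def shiftAct : AddMonoidAlgebra R G →ₐ[R] Module.End R (G → M) :=
  AddMonoidAlgebra.lift R _ G
    { toFun := fun v =>
        { toFun := fun F k => F (k + v.toAdd)
          map_add' := fun _ _ => rfl
          map_smul' := fun _ _ => rfl }
      map_one' := by ext; simp
      map_mul' := fun u v => by ext F k; simp [add_assoc] }

theorem shiftAct_single (v : G) (c : R) (F : G → M) (k : G) :
    shiftAct (AddMonoidAlgebra.single v c) F k = c • F (k + v) := by
  simp [shiftAct]

theorem shiftAct_comp {H : Type*} [AddCommMonoid H] (φ : G →+ H) {h : G → H}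
    (hh : ∀ l v, h (l + v) = h l + φ v) (x : AddMonoidAlgebra R G) (F : H → M) (l : G) :
    shiftAct x (F ∘ h) l = shiftAct (AddMonoidAlgebra.mapDomainAlgHom R R φ x) F (h l) := by
  induction x using AddMonoidAlgebra.induction_linear with
  | zero => simp
  | add x y hx hy => simp only [map_add, LinearMap.add_apply, Pi.add_apply, hx, hy]
  | single v c => simp [shiftAct_single, hh]

end ShiftAction

section ShiftAlgebra

/-- The group algebra of `ℤ^ι`, thought of as the algebra of Laurent polynomials in the shift
operators `E_i`, `i : ι`. -/
abbrev ShiftAlg (ι : Type*) : Type _ := AddMonoidAlgebra ℂ (ι → ℤ)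

variable {ι κ : Type*} [DecidableEq ι] [DecidableEq κ]

/-- The shift operator `E_i`. -/
def shiftVar (i : ι) : ShiftAlg ι := AddMonoidAlgebra.single (Pi.single i 1) 1

/-- The substitution `X ↦ E_s`, `Y ↦ E_t`. -/
def substShift (s t : ι) : Laurent₂ →ₐ[ℂ] ShiftAlg ι :=
  AddMonoidAlgebra.mapDomainAlgHom ℂ ℂ
    ((AddMonoidHom.single (fun _ : ι => ℤ) s).coprod (AddMonoidHom.single (fun _ : ι => ℤ) t))

theorem shiftAct_shiftVar (i : ι) (F : (ι → ℤ) → ℂ) (k : ι → ℤ) :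
    shiftAct (shiftVar i) F k = F (k + Pi.single i 1) := by
  rw [shiftVar, shiftAct_single, one_smul]

theorem shiftAct_shiftVar_sub_one (i : ι) (F : (ι → ℤ) → ℂ) (k : ι → ℤ) :
    shiftAct (shiftVar i - 1) F k = F (k + Pi.single i 1) - F k := by
  simp [shiftAct_shiftVar]

theorem substShift_single (s t : ι) (p : ℤ × ℤ) (c : ℂ) :
    substShift s t (AddMonoidAlgebra.single p c) =
      AddMonoidAlgebra.single (Pi.single s p.1 + Pi.single t p.2) c := by
  simp [substShift]

theorem substShift_X (s t : ι) : substShift s t X = shiftVar s := by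
  simp [X, substShift_single, shiftVar]

theorem substShift_Y (s t : ι) : substShift s t Y = shiftVar t := by
  simp [Y, substShift_single, shiftVar]

theorem mapDomain_shiftVar {φ : (ι → ℤ) →+ (κ → ℤ)} {i : ι} {i' : κ}
    (h : ∀ c, φ (Pi.single i c) = Pi.single i' c) :
    AddMonoidAlgebra.mapDomainAlgHom ℂ ℂ φ (shiftVar i) = shiftVar i' := by
  simp [shiftVar, h]

theorem mapDomain_substShift {φ : (ι → ℤ) →+ (κ → ℤ)} {s t : ι} {s' t' : κ}
    (hs : ∀ c, φ (Pi.single s c) = Pi.single s' c) (ht : ∀ c, φ (Pi.single t c) = Pi.single t' c)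
    (r : Laurent₂) :
    AddMonoidAlgebra.mapDomainAlgHom ℂ ℂ φ (substShift s t r) = substShift s' t' r := by
  induction r using AddMonoidAlgebra.induction_linear with
  | zero => simp
  | add a b ha hb => simp only [map_add, ha, hb]
  | single p c => simp [substShift_single, hs, ht]

theorem evalShift_eq_shiftAct {n : ℕ} (r : Laurent₂) (s t : Fin n) :
    evalShift r s t = shiftAct (substShift s t r) := by
  induction r using AddMonoidAlgebra.induction_linear with
  | zero => simp [evalShift]
  | add a b ha hb =>
    rw [map_add, map_add, ← ha, ← hb, evalShift, AddMonoidAlgebra.coeff_add,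
      Finsupp.sum_add_index' (by simp) fun _ _ _ => by rw [add_smul]]
    rfl
  | single p c =>
    ext F k
    rw [evalShift, AddMonoidAlgebra.coeff_single, Finsupp.sum_single_index (by simp),
      substShift_single, shiftAct_single]
    simp [shiftPow, add_assoc]

end ShiftAlgebra

section PairProduct

/-- The element `∏_{s < t} r(E_s, E_t)` of the group algebra. -/
def pairProd (ι : Type*) [Fintype ι] [LinearOrder ι] (r : Laurent₂) : ShiftAlg ι :=
  ∏ p : ι × ι with p.1 < p.2, substShift p.1 p.2 r

theorem prodOperator_eq_shiftAct (n : ℕ) (r : Laurent₂) :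
    prodOperator n r = shiftAct (pairProd (Fin n) r) := by
  have h := Finset.map_noncommProd {p : Fin n × Fin n | p.1 < p.2} (fun p => substShift p.1 p.2 r)
    (fun _ _ _ _ _ => Commute.all _ _) (shiftAct (M := ℂ))
  rw [Finset.noncommProd_eq_prod] at h
  rw [pairProd, h]
  exact Finset.noncommProd_congr rfl (fun _ _ => evalShift_eq_shiftAct _ _ _) _

theorem pairProd_fin_succ {n : ℕ} (r : Laurent₂) (p : Fin (n + 1)) :
    pairProd (Fin (n + 1)) r =
      (∏ t : Fin n, if p < p.succAbove t then substShift p (p.succAbove t) r else 1) *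
      (∏ s : Fin n, if p.succAbove s < p then substShift (p.succAbove s) p r else 1) *
      ∏ q : Fin n × Fin n with q.1 < q.2, substShift (p.succAbove q.1) (p.succAbove q.2) r := by
  simp only [pairProd, Finset.prod_filter, Fintype.prod_prod_type, Fin.prod_univ_succAbove _ p,
    lt_irrefl, if_false, one_mul, Finset.prod_mul_distrib, Fin.succAbove_lt_succAbove_iff,
    mul_assoc]

end PairProduct

section Telescoping

theorem sum_Icc_add_one_sub {M : Type*} [AddCommGroup M] {a b : ℤ} (h : a ≤ b + 1) (g : ℤ → M) :
    ∑ x ∈ Finset.Icc a b, (g (x + 1) - g x) = g (b + 1) - g a := by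
  have hrange := Finset.sum_range_sub (fun i : ℕ => g (a + i)) (b + 1 - a).toNat
  rw [Int.toNat_of_nonneg (by lia), add_sub_cancel, Nat.cast_zero, add_zero] at hrange
  rw [Int.Icc_eq_finset_map, Finset.sum_map, ← hrange]
  simp [add_assoc]

theorem extSum_add_one_sub (a b : ℤ) (g : ℤ → ℂ) :
    extSum a b (fun x => g (x + 1) - g x) = g (b + 1) - g a := by
  unfold extSum
  split_ifs with h
  · exact sum_Icc_add_one_sub (by lia) g
  · rw [sum_Icc_add_one_sub (by lia) g, sub_add_cancel, neg_sub]

theorem extSum_sub (a b : ℤ) (g h : ℤ → ℂ) :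
    extSum a b (fun x => g x - h x) = extSum a b g - extSum a b h := by
  simp only [extSum, Finset.sum_sub_distrib]
  split_ifs <;> ring

theorem sumOp_sub (S : Finset (ℤ × ℤ)) (f : S → ℂ) : ∀ (m : ℕ) (k : Fin (m + 1) → ℤ)
    (A B : (Fin m → ℤ) → ℂ),
    sumOp S f m k (fun l => A l - B l) = sumOp S f m k A - sumOp S f m k B
  | 0, _, _, _ => rfl
  | 1, _, _, _ => by simp only [sumOp, extSum_sub]
  | m + 2, _, _, _ => by
    simp only [sumOp, sumOp_sub S f (m + 1), sumOp_sub S f m, extSum_sub, mul_sub,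
      Finset.sum_sub_distrib]
    ring

end Telescoping

local notation:67 l:67 " ∷ʳ " x:68 => Fin.snoc (α := fun _ => ℤ) l x

section Snoc

variable {m : ℕ}

/-- The inclusion `ℤ^m → ℤ^(m+1)` appending a zero. -/
def snocZero (m : ℕ) : (Fin m → ℤ) →+ (Fin (m + 1) → ℤ) where
  toFun v := v ∷ʳ 0
  map_zero' := by
    ext i
    cases i using Fin.lastCases <;> simp
  map_add' u v := by
    ext i
    cases i using Fin.lastCases <;> simp

theorem snocZero_single (i : Fin m) (c : ℤ) :
    snocZero m (Pi.single i c) = Pi.single i.castSucc c := by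
  ext j
  cases j using Fin.lastCases <;> simp [snocZero, Fin.castSucc_ne_last, Pi.single_apply]

theorem snoc_add (x : ℤ) (l v : Fin m → ℤ) : (l + v) ∷ʳ x = l ∷ʳ x + snocZero m v := by
  ext j
  cases j using Fin.lastCases <;> simp [snocZero]

theorem snoc_add_single_last (l : Fin m → ℤ) (x c : ℤ) :
    l ∷ʳ x + Pi.single (Fin.last m) c = l ∷ʳ (x + c) := by
  ext j
  cases j using Fin.lastCases <;> simp [Fin.castSucc_ne_last]

theorem snoc_add_single_castSucc (l : Fin m → ℤ) (x c : ℤ) (i : Fin m) :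
    l ∷ʳ x + Pi.single i.castSucc c = (l + Pi.single i c) ∷ʳ x := by
  rw [snoc_add, snocZero_single]

theorem shiftAct_snoc (u : ShiftAlg (Fin m)) (B : (Fin (m + 1) → ℤ) → ℂ) (l : Fin m → ℤ) (x : ℤ) :
    shiftAct u (fun l' => B (l' ∷ʳ x)) l =
      shiftAct (AddMonoidAlgebra.mapDomainAlgHom ℂ ℂ (snocZero m) u) B (l ∷ʳ x) :=
  shiftAct_comp (snocZero m) (snoc_add x) u B l

end Snoc

section MixedDifference

/-- The mixed difference operator `∏ (E_i - 1)`. -/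
def mixedDiff (ι : Type*) [Fintype ι] [DecidableEq ι] : ShiftAlg ι := ∏ i, (shiftVar i - 1)

theorem shiftAct_mixedDiff_snoc {m : ℕ} (B : (Fin (m + 1) → ℤ) → ℂ) (l : Fin m → ℤ) (x : ℤ) :
    shiftAct (mixedDiff (Fin (m + 1))) B (l ∷ʳ x) =
      shiftAct (mixedDiff (Fin m)) (fun l' => B (l' ∷ʳ (x + 1)) - B (l' ∷ʳ x)) l := by
  have hsplit : mixedDiff (Fin (m + 1)) =
      AddMonoidAlgebra.mapDomainAlgHom ℂ ℂ (snocZero m) (mixedDiff (Fin m)) *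
        (shiftVar (Fin.last m) - 1) := by
    simp only [mixedDiff, Fin.prod_univ_castSucc, map_prod, map_sub, map_one,
      mapDomain_shiftVar (snocZero_single _)]
  rw [hsplit, map_mul, Module.End.mul_apply, ← shiftAct_snoc]
  simp only [shiftAct_shiftVar_sub_one, snoc_add_single_last]

theorem shiftAct_prod_shiftVar_sub_one {ι : Type*} [Fintype ι] [DecidableEq ι] (A : Finset ι)
    (g : ι → ℤ → ℂ) :
    shiftAct (∏ i ∈ A, (shiftVar i - 1)) (fun k => ∏ i, g i (k i)) =
      fun k => ∏ i, A.piecewise (fun i => fwdDiff 1 (g i)) g i (k i) := by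
  induction A using Finset.induction_on with
  | empty => simp
  | insert a A ha ih =>
    rw [Finset.prod_insert ha, map_mul, Module.End.mul_apply, ih, Finset.piecewise_insert]
    ext k
    set h := A.piecewise (fun i => fwdDiff 1 (g i)) g
    have hga : g a = h a := (Finset.piecewise_eq_of_notMem _ _ _ ha).symm
    have hrest : ∀ v : ι → ℤ, (∀ i ≠ a, v i = k i) → ∀ u : ℤ → ℂ,
        ∏ i, Function.update h a u i (v i) = u (v a) * ∏ i ∈ {a}ᶜ, h i (k i) := by
      intro v hv u
      rw [Fintype.prod_eq_mul_prod_compl a, Function.update_self]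
      congr 1
      refine Finset.prod_congr rfl fun i hi => ?_
      have hia : i ≠ a := by simpa using hi
      rw [Function.update_of_ne hia, hv i hia]
    have hk := hrest k (fun _ _ => rfl)
    have hka := hrest (k + Pi.single a 1) (fun i hi => by simp [hi]) (h a)
    have hk' := hk (h a)
    rw [Function.update_eq_self] at hka hk'
    rw [shiftAct_shiftVar_sub_one, hka, hk', hk, hga, ← sub_mul]
    simp [fwdDiff]

end MixedDifference

section Kernel

/-- The Laurent polynomial `r(X, Y) = Y + (X - 1)(Y - 1) s(X, Y)`. -/
abbrev kernelOf (s : Laurent₂) : Laurent₂ := Y + (X - 1) * (Y - 1) * s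

/-- The functions `B` for which `r(E_j, E_i) B` vanishes where the arguments `i` and `j` agree,
for all consecutive indices `i ⋖ j`. -/
def AdjacentVanishing {ι : Type*} [LinearOrder ι] (r : Laurent₂) (B : (ι → ℤ) → ℂ) : Prop :=
  ∀ ⦃i j : ι⦄, i ⋖ j → ∀ k : ι → ℤ, k i = k j → shiftAct (substShift j i r) B k = 0

theorem AdjacentVanishing.snoc {r : Laurent₂} {m : ℕ} {B : (Fin (m + 1) → ℤ) → ℂ}
    (hB : AdjacentVanishing r B) (x : ℤ) : AdjacentVanishing r fun l => B (l ∷ʳ x) := by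
  intro i j hij l hl
  rw [shiftAct_snoc, mapDomain_substShift (snocZero_single j) (snocZero_single i)]
  exact hB (by simpa [Fin.covBy_iff] using hij) _ (by simpa using hl)

variable {S : Finset (ℤ × ℤ)} {f : S → ℂ}

theorem shiftAct_substShift_kernelOf {ι : Type*} [DecidableEq ι] (s t : ι) (B : (ι → ℤ) → ℂ)
    (k : ι → ℤ) :
    shiftAct (substShift s t (kernelOf (laurentOf S f))) B k =
      B (k + Pi.single t 1) - ∑ p : S, f p *
        shiftAct ((shiftVar s - 1) * (shiftVar t - 1)) B
          (k + (Pi.single s p.1.2 + Pi.single t p.1.1)) := by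
  have hsubst : substShift s t (kernelOf (laurentOf S f)) = shiftVar t - ∑ p : S,
      AddMonoidAlgebra.single (Pi.single s p.1.2 + Pi.single t p.1.1) (f p) *
        ((shiftVar s - 1) * (shiftVar t - 1)) := by
    simp only [kernelOf, laurentOf, map_add, map_mul, map_sub, map_one, map_neg, map_sum,
      substShift_X, substShift_Y, substShift_single]
    rw [← Finset.sum_mul]
    ring
  rw [hsubst, map_sub, map_sum]
  simp only [LinearMap.sub_apply, Pi.sub_apply, LinearMap.sum_apply, Finset.sum_apply,
    shiftAct_shiftVar]
  congr! with p
  rw [map_mul, Module.End.mul_apply, shiftAct_single, smul_eq_mul]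

theorem AdjacentVanishing.sum_mul_mixedDiff_snoc_snoc {m : ℕ} {B : (Fin (m + 2) → ℤ) → ℂ}
    (hB : AdjacentVanishing (kernelOf (laurentOf S f)) B) (l : Fin m → ℤ) (y : ℤ) :
    ∑ p : S, f p * shiftAct (mixedDiff (Fin (m + 2))) B (l ∷ʳ (y + p.1.1) ∷ʳ (y + p.1.2)) =
      shiftAct (mixedDiff (Fin m)) (fun l' => B (l' ∷ʳ (y + 1) ∷ʳ y)) l := by
  have hdiag : (fun l' : Fin m → ℤ => B (l' ∷ʳ (y + 1) ∷ʳ y)) = ∑ p : S, f p • fun l' =>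
      (B (l' ∷ʳ (y + p.1.1 + 1) ∷ʳ (y + p.1.2 + 1)) - B (l' ∷ʳ (y + p.1.1 + 1) ∷ʳ (y + p.1.2))) -
      (B (l' ∷ʳ (y + p.1.1) ∷ʳ (y + p.1.2 + 1)) - B (l' ∷ʳ (y + p.1.1) ∷ʳ (y + p.1.2))) := by
    ext l'
    have hzero := hB (i := (Fin.last m).castSucc) (j := Fin.last (m + 1)) (by simp [Fin.covBy_iff])
      (l' ∷ʳ y ∷ʳ y) (by simp)
    rw [shiftAct_substShift_kernelOf, sub_eq_zero, snoc_add_single_castSucc,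
      snoc_add_single_last] at hzero
    rw [hzero, Finset.sum_apply]
    refine Finset.sum_congr rfl fun p _ => ?_
    simp only [map_mul, Module.End.mul_apply, shiftAct_shiftVar_sub_one, ← add_assoc,
      snoc_add_single_last, snoc_add_single_castSucc, Pi.smul_apply, smul_eq_mul]
    ring
  rw [hdiag]
  simp only [map_sum, map_smul, Finset.sum_apply, Pi.smul_apply, smul_eq_mul,
    shiftAct_mixedDiff_snoc]

end Kernel

section DeleteShift

variable {m : ℕ}

/-- Deletion of the entry `p`, with all later entries increased by one. -/
def deleteShift (p : Fin (m + 1)) (k : Fin (m + 1) → ℤ) : Fin m → ℤ :=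
  fun i => k (p.succAbove i) + if p < p.succAbove i then 1 else 0

theorem deleteShift_castSucc (p : Fin (m + 1)) (k : Fin (m + 2) → ℤ) :
    deleteShift p.castSucc k = deleteShift p (Fin.init k) ∷ʳ (k (Fin.last (m + 1)) + 1) := by
  ext i
  cases i using Fin.lastCases with
  | last => simp [deleteShift, Fin.castSucc_lt_last]
  | cast i => simp [deleteShift, Fin.init]

theorem deleteShift_last (k : Fin (m + 1) → ℤ) : deleteShift (Fin.last m) k = Fin.init k := by
  ext i
  simp [deleteShift, Fin.init, Fin.le_last]

theorem sum_deleteShift_succ (B : (Fin (m + 1) → ℤ) → ℂ) (k : Fin (m + 2) → ℤ) :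
    ∑ p : Fin (m + 2), (-1) ^ (p : ℕ) * B (deleteShift p k) =
      ∑ p : Fin (m + 1), (-1) ^ (p : ℕ) *
          B (deleteShift p (Fin.init k) ∷ʳ (k (Fin.last (m + 1)) + 1)) +
        (-1) ^ (m + 1) * B (Fin.init k) := by
  simp only [Fin.sum_univ_castSucc (n := m + 1), deleteShift_castSucc, deleteShift_last,
    Fin.val_castSucc, Fin.val_last]

end DeleteShift

section SumOp

variable {S : Finset (ℤ × ℤ)} {f : S → ℂ}

theorem extSum_sumOp_mixedDiff {m : ℕ} (a b : ℤ) (k : Fin (m + 1) → ℤ)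
    (B : (Fin (m + 1) → ℤ) → ℂ) :
    extSum a b (fun x => sumOp S f m k fun l =>
        shiftAct (mixedDiff (Fin (m + 1))) B (l ∷ʳ x)) =
      sumOp S f m k (shiftAct (mixedDiff (Fin m)) fun l => B (l ∷ʳ (b + 1))) -
        sumOp S f m k (shiftAct (mixedDiff (Fin m)) fun l => B (l ∷ʳ a)) := by
  rw [← extSum_add_one_sub a b fun x =>
    sumOp S f m k (shiftAct (mixedDiff (Fin m)) fun l => B (l ∷ʳ x))]
  congr! with x
  rw [← sumOp_sub]
  congr! with l
  rw [shiftAct_mixedDiff_snoc, ← Pi.sub_apply, ← map_sub]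
  rfl

theorem AdjacentVanishing.sumOp_mixedDiff : ∀ {m : ℕ} {B : (Fin m → ℤ) → ℂ},
    AdjacentVanishing (kernelOf (laurentOf S f)) B → ∀ k : Fin (m + 1) → ℤ,
      sumOp S f m k (shiftAct (mixedDiff (Fin m)) B) =
        ∑ p : Fin (m + 1), (-1) ^ (p : ℕ) * B (deleteShift p k)
  | 0, B, _, k => by
    simp [sumOp, mixedDiff, Subsingleton.elim (deleteShift 0 k) Fin.elim0]
  | 1, B, hB, k => by
    have hinit : Fin.elim0 ∷ʳ k 0 = Fin.init k := by
      ext i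
      obtain rfl : i = 0 := Subsingleton.elim (α := Fin 1) i 0
      rfl
    rw [sumOp, extSum_sumOp_mixedDiff, (hB.snoc _).sumOp_mixedDiff, (hB.snoc _).sumOp_mixedDiff,
      sum_deleteShift_succ]
    simp [Subsingleton.elim (deleteShift _ _) Fin.elim0, hinit, sub_eq_add_neg]
  | m + 2, B, hB, k => by
    rw [sumOp]
    simp only [hB.sum_mul_mixedDiff_snoc_snoc]
    rw [extSum_sumOp_mixedDiff, (hB.snoc _).sumOp_mixedDiff, (hB.snoc _).sumOp_mixedDiff,
      ((hB.snoc _).snoc _).sumOp_mixedDiff, sum_deleteShift_succ B k,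
      sum_deleteShift_succ (fun l => B (l ∷ʳ Fin.init k (Fin.last (m + 1)))) (Fin.init k),
      Fin.snoc_init_self]
    ring

end SumOp

section BinomialDeterminant

/-- The determinant of the matrix with entries `binom (x_i, j + c)`, `0 ≤ i, j < n`. -/
def binomialDet {R : Type*} [CommRing R] [BinomialRing R] {n : ℕ} (c : ℕ) (x : Fin n → R) : R :=
  (Matrix.of fun i j : Fin n => Ring.choose (x i) (j + c)).det

section

variable {R : Type*} [CommRing R] [BinomialRing R] {n : ℕ}

theorem binomialDet_comp_swap (c : ℕ) (x : Fin n → R) {i j : Fin n} (hij : i ≠ j) :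
    binomialDet c (x ∘ Equiv.swap i j) = -binomialDet c x := by
  have h := Matrix.det_permute (Equiv.swap i j)
    (Matrix.of fun a b : Fin n => Ring.choose (x a) (b + c))
  rw [Equiv.Perm.sign_swap hij, Units.val_neg, Units.val_one, Int.cast_neg, Int.cast_one,
    neg_one_mul] at h
  exact h

theorem binomialDet_zero_succ (x : Fin (n + 1) → R) :
    binomialDet 0 x =
      ∑ p : Fin (n + 1), (-1) ^ (p : ℕ) * binomialDet 1 fun i => x (p.succAbove i) := by
  rw [binomialDet, Matrix.det_succ_column_zero]
  simp [binomialDet, Matrix.submatrix]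

theorem binomialDet_zero_natCast : binomialDet 0 (fun i : Fin n => ((i : ℕ) : R)) = 1 := by
  rw [binomialDet, Matrix.det_of_isLowerTriangular]
  · simp [Ring.choose_natCast]
  · intro i j hij
    have hlt : (i : ℕ) < j := hij
    simp [Ring.choose_natCast, Nat.choose_eq_zero_of_lt hlt]

theorem prod_factorial_mul_binomialDet_zero (x : Fin n → R) :
    (∏ j : Fin n, ((j : ℕ).factorial : R)) * binomialDet 0 x =
      ∏ p : Fin n × Fin n with p.1 < p.2, (x p.2 - x p.1) := by
  nontriviality R
  have hvandermonde : ∏ p : Fin n × Fin n with p.1 < p.2, (x p.2 - x p.1) =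
      (Matrix.vandermonde x).det := by
    simp only [Matrix.det_vandermonde, Finset.prod_filter, Fintype.prod_prod_type,
      ← Finset.filter_lt_eq_Ioi]
  rw [hvandermonde, binomialDet, ← Matrix.det_mul_row,
    Matrix.det_eval_matrixOfPolynomials_eq_det_vandermonde x
      (fun j => (descPochhammer ℤ j).map (Int.castRingHom R))
      (fun j => ((monic_descPochhammer ℤ j).natDegree_map _).trans (descPochhammer_natDegree ℤ j))
      fun j => (monic_descPochhammer ℤ j).map _]
  congr 1
  ext i j
  rw [Matrix.of_apply, Matrix.of_apply, Matrix.of_apply, add_zero, ← nsmul_eq_mul,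
    ← Ring.descPochhammer_eq_factorial_smul_choose, ← Polynomial.aeval_eq_smeval,
    Polynomial.eval_map, Polynomial.aeval_def]
  rfl

end

theorem gtProduct_eq_binomialDet (n : ℕ) (k : Fin n → ℤ) :
    gtProduct n k = binomialDet 0 fun i => (k i : ℂ) := by
  have hk := prod_factorial_mul_binomialDet_zero fun i => (k i : ℂ)
  have hid := prod_factorial_mul_binomialDet_zero fun i : Fin n => ((i : ℕ) : ℂ)
  rw [binomialDet_zero_natCast, mul_one] at hid
  have hne : ∏ j : Fin n, ((j : ℕ).factorial : ℂ) ≠ 0 :=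
    Finset.prod_ne_zero_iff.mpr fun j _ => Nat.cast_ne_zero.mpr (Nat.factorial_ne_zero _)
  rw [gtProduct, Finset.prod_div_distrib, ← hk, ← hid, mul_div_cancel_left₀ _ hne]

theorem shiftAct_mixedDiff_binomialDet (n c : ℕ) :
    shiftAct (mixedDiff (Fin n)) (fun k => binomialDet (c + 1) fun i => (k i : ℂ)) =
      fun k => binomialDet c fun i => (k i : ℂ) := by
  have hdet : ∀ c, (fun k : Fin n → ℤ => binomialDet c fun i => (k i : ℂ)) =
      ∑ σ : Equiv.Perm (Fin n), (Equiv.Perm.sign σ : ℂ) •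
        fun k => ∏ i, Ring.choose (k i : ℂ) (σ i + c) := by
    intro c
    ext k
    simp [binomialDet, ← Matrix.det_transpose (Matrix.of _), Matrix.det_apply']
  have hchoose : ∀ a : ℕ, fwdDiff 1 (fun x : ℤ => Ring.choose (x : ℂ) (a + (c + 1))) =
      fun x : ℤ => Ring.choose (x : ℂ) (a + c) := by
    intro a
    ext x
    simp [fwdDiff, ← add_assoc, Ring.choose_succ_succ]
  simp only [hdet, map_sum, map_smul, mixedDiff]
  refine Finset.sum_congr rfl fun σ _ => ?_
  rw [shiftAct_prod_shiftVar_sub_one Finset.univ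
    fun i x => Ring.choose (x : ℂ) (σ i + (c + 1))]
  simp only [Finset.piecewise_univ, hchoose]

end BinomialDeterminant

section Relabel

variable {ι κ : Type*}

/-- The restriction of vectors along a map of index sets. -/
def pullIndex (e : κ → ι) : (ι → ℤ) →+ (κ → ℤ) where
  toFun v := v ∘ e
  map_zero' := rfl
  map_add' _ _ := rfl

theorem shiftAct_comp_pullIndex (e : κ → ι) (x : ShiftAlg ι) (F : (κ → ℤ) → ℂ) (k : ι → ℤ) :
    shiftAct x (fun l => F (l ∘ e)) k =
      shiftAct (AddMonoidAlgebra.mapDomainAlgHom ℂ ℂ (pullIndex e) x) F (k ∘ e) :=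
  shiftAct_comp (pullIndex e) (fun _ _ => rfl) x F k

variable [DecidableEq ι]

theorem pullIndex_single [DecidableEq κ] {e : κ → ι} (he : Function.Injective e) (i : κ) (c : ℤ) :
    pullIndex e (Pi.single (e i) c) = Pi.single i c := by
  ext j
  simp [pullIndex, Pi.single_apply, he.eq_iff]

theorem mapDomain_pullIndex_shiftVar_of_notMem_range {e : κ → ι} {i : ι} (hi : i ∉ Set.range e) :
    AddMonoidAlgebra.mapDomainAlgHom ℂ ℂ (pullIndex e) (shiftVar i) = 1 := by
  have hzero : pullIndex e (Pi.single i 1) = 0 := by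
    ext j
    exact Pi.single_eq_of_ne (fun h => hi ⟨j, h⟩) 1
  simp [shiftVar, hzero, AddMonoidAlgebra.one_def]

theorem prod_ite_shiftVar [Fintype ι] (P : ι → Prop) [DecidablePred P] :
    (∏ i, if P i then shiftVar i else 1) =
      (AddMonoidAlgebra.single (fun i => if P i then 1 else 0) 1 : ShiftAlg ι) := by
  have hprod : ∀ A : Finset ι, ∏ i ∈ A, shiftVar i =
      (AddMonoidAlgebra.single (∑ i ∈ A, Pi.single i 1) 1 : ShiftAlg ι) := by
    intro A
    induction A using Finset.induction_on with
    | empty => simp [AddMonoidAlgebra.one_def]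
    | insert a A ha ih =>
      rw [Finset.prod_insert ha, Finset.sum_insert ha, ih, shiftVar,
        AddMonoidAlgebra.single_mul_single, one_mul]
  rw [← Finset.prod_filter, hprod]
  congr 1
  ext j
  simp [Finset.sum_apply, Pi.single_apply]

end Relabel

section PairProduct

theorem mapDomain_swap_substShift_mul_pairProd {ι : Type*} [Fintype ι] [LinearOrder ι]
    (r : Laurent₂) {i j : ι} (hij : i ⋖ j) :
    AddMonoidAlgebra.mapDomainAlgHom ℂ ℂ (pullIndex (Equiv.swap i j))
      (substShift j i r * pairProd ι r) = substShift j i r * pairProd ι r := by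
  have hinsert : substShift j i r * pairProd ι r =
      ∏ p ∈ insert (j, i) (Finset.univ.filter fun p : ι × ι => p.1 < p.2),
        substShift p.1 p.2 r := by
    rw [Finset.prod_insert (by simp [hij.lt.le]), pairProd]
  rw [hinsert, map_prod]
  refine Finset.prod_equiv ((Equiv.swap i j).prodCongr (Equiv.swap i j)) ?_ ?_
  · rintro ⟨a, b⟩
    have hlt : i < j := hij.lt
    have ha : i < a → j ≤ a := hij.ge_of_gt
    have hb : i < b → j ≤ b := hij.ge_of_gt
    simp only [Finset.mem_insert, Prod.mk.injEq, Finset.mem_filter, Finset.mem_univ, true_and,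
      Equiv.prodCongr_apply, Prod.map, Equiv.swap_apply_def]
    grind
  · intro p _
    have hsingle := pullIndex_single (Equiv.swap i j).injective
    refine mapDomain_substShift (fun c => ?_) (fun c => ?_) r
    · simpa using hsingle (Equiv.swap i j p.1) c
    · simpa using hsingle (Equiv.swap i j p.2) c

theorem adjacentVanishing_shiftAct_pairProd {ι : Type*} [Fintype ι] [LinearOrder ι] (r : Laurent₂)
    {F : (ι → ℤ) → ℂ} (hF : ∀ i j : ι, i ≠ j → ∀ k, F (k ∘ Equiv.swap i j) = -F k) :
    AdjacentVanishing r (shiftAct (pairProd ι r) F) := by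
  intro i j hij k hk
  have hswap : k ∘ Equiv.swap i j = k := by
    ext a
    simp only [Function.comp_apply, Equiv.swap_apply_def]
    split_ifs <;> simp_all
  have h := shiftAct_comp_pullIndex (Equiv.swap i j) (substShift j i r * pairProd ι r) F k
  rw [mapDomain_swap_substShift_mul_pairProd r hij, hswap, funext (hF i j hij.ne)] at h
  rw [← Module.End.mul_apply, ← map_mul]
  exact self_eq_neg.mp (h.symm.trans (congrFun (map_neg _ F) k))

theorem map_kernelOf_of_map_X_eq_one {A : Type*} [CommRing A] (φ : Laurent₂ →+* A) (s : Laurent₂)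
    (hX : φ X = 1) : φ (kernelOf s) = φ Y := by
  simp [hX]

theorem map_kernelOf_of_map_Y_eq_one {A : Type*} [CommRing A] (φ : Laurent₂ →+* A) (s : Laurent₂)
    (hY : φ Y = 1) : φ (kernelOf s) = 1 := by
  simp [hY]

theorem mapDomain_succAbove_pairProd_kernelOf {n : ℕ} (s : Laurent₂) (p : Fin (n + 1)) :
    AddMonoidAlgebra.mapDomainAlgHom ℂ ℂ (pullIndex p.succAbove)
        (pairProd (Fin (n + 1)) (kernelOf s)) =
      (∏ t : Fin n, if p < p.succAbove t then shiftVar t else 1) *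
        pairProd (Fin n) (kernelOf s) := by
  set Φ := AddMonoidAlgebra.mapDomainAlgHom ℂ ℂ (pullIndex p.succAbove)
  have hsingle := pullIndex_single (Fin.succAbove_right_injective (p := p))
  have hp : Φ (shiftVar p) = 1 :=
    mapDomain_pullIndex_shiftVar_of_notMem_range fun ⟨i, hi⟩ => Fin.succAbove_ne p i hi
  have hafter : ∀ t, Φ (substShift p (p.succAbove t) (kernelOf s)) = shiftVar t := fun t =>
    (map_kernelOf_of_map_X_eq_one (Φ.comp (substShift p (p.succAbove t))).toRingHom s
      ((congrArg Φ (substShift_X _ _)).trans hp)).trans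
      ((congrArg Φ (substShift_Y _ _)).trans (mapDomain_shiftVar (hsingle t)))
  have hbefore : ∀ t, Φ (substShift (p.succAbove t) p (kernelOf s)) = 1 := fun t =>
    map_kernelOf_of_map_Y_eq_one (Φ.comp (substShift (p.succAbove t) p)).toRingHom s
      ((congrArg Φ (substShift_Y _ _)).trans hp)
  have hother : ∀ t u, Φ (substShift (p.succAbove t) (p.succAbove u) (kernelOf s)) =
      substShift t u (kernelOf s) := fun t u => mapDomain_substShift (hsingle t) (hsingle u) _
  rw [pairProd_fin_succ _ p]
  simp only [map_mul, map_prod, apply_ite Φ, map_one, hafter, hbefore, hother, ite_self,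
    Finset.prod_const_one, mul_one, pairProd]

theorem shiftAct_pairProd_kernelOf_comp_succAbove {n : ℕ} (s : Laurent₂) (p : Fin (n + 1))
    (F : (Fin n → ℤ) → ℂ) (k : Fin (n + 1) → ℤ) :
    shiftAct (pairProd (Fin (n + 1)) (kernelOf s)) (fun l => F (l ∘ p.succAbove)) k =
      shiftAct (pairProd (Fin n) (kernelOf s)) F (deleteShift p k) := by
  rw [shiftAct_comp_pullIndex, mapDomain_succAbove_pairProd_kernelOf, prod_ite_shiftVar, map_mul,
    Module.End.mul_apply, shiftAct_single, one_smul]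
  rfl

theorem prodOperator_gtProduct_eq_alpha (S : Finset (ℤ × ℤ)) (f : S → ℂ) : ∀ n : ℕ,
    prodOperator n (kernelOf (laurentOf S f)) (gtProduct n) = alpha S f n
  | 0 => by
    ext k
    simp [prodOperator_eq_shiftAct, pairProd, alpha, gtProduct]
  | n + 1 => by
    set r := kernelOf (laurentOf S f) with hr
    let D (m c : ℕ) (k : Fin m → ℤ) : ℂ := binomialDet c fun i => (k i : ℂ)
    have hD (m : ℕ) : gtProduct m = D m 0 := funext (gtProduct_eq_binomialDet m)
    have hanti : AdjacentVanishing r (shiftAct (pairProd (Fin n) r) (D n 1)) :=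
      adjacentVanishing_shiftAct_pairProd r fun i j hij k =>
        binomialDet_comp_swap 1 (fun i => (k i : ℂ)) hij
    have hlaplace : D (n + 1) 0 = ∑ p : Fin (n + 1), (-1 : ℂ) ^ (p : ℕ) •
        fun l => D n 1 (l ∘ p.succAbove) := by
      ext l
      simp [D, binomialDet_zero_succ]
    ext k
    calc prodOperator (n + 1) r (gtProduct (n + 1)) k
        = ∑ p : Fin (n + 1), (-1) ^ (p : ℕ) *
            shiftAct (pairProd (Fin n) r) (D n 1) (deleteShift p k) := by
          rw [prodOperator_eq_shiftAct, hD, hlaplace]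
          simp [hr, shiftAct_pairProd_kernelOf_comp_succAbove]
      _ = sumOp S f n k (shiftAct (mixedDiff (Fin n) * pairProd (Fin n) r) (D n 1)) := by
          rw [map_mul, Module.End.mul_apply, hanti.sumOp_mixedDiff]
      _ = sumOp S f n k (shiftAct (pairProd (Fin n) r) (D n 0)) := by
          rw [mul_comm, map_mul, Module.End.mul_apply, shiftAct_mixedDiff_binomialDet n 0]
      _ = alpha S f (n + 1) k := by
          rw [← hD, ← prodOperator_eq_shiftAct, prodOperator_gtProduct_eq_alpha S f n, alpha]

end PairProduct

section Rows

variable {n m : ℕ}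

/-- The extension of a finite row by zeros, indexed from `0`. -/
def rowExt (k : Fin n → ℤ) (j : ℕ) : ℤ := if h : j < n then k ⟨j, h⟩ else 0

theorem rowExt_of_lt (k : Fin n → ℤ) {j : ℕ} (h : j < n) : rowExt k j = k ⟨j, h⟩ :=
  dif_pos h

theorem rowExt_val (k : Fin n → ℤ) (j : Fin n) : rowExt k j = k j := rowExt_of_lt k j.2

theorem rowExt_of_le (k : Fin n → ℤ) {j : ℕ} (h : n ≤ j) : rowExt k j = 0 :=
  dif_neg h.not_gt

theorem rowExt_snoc_self (l : Fin m → ℤ) (x : ℤ) : rowExt (l ∷ʳ x) m = x := by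
  rw [rowExt_of_lt _ m.lt_succ_self]
  exact Fin.snoc_last _ _

theorem rowExt_snoc_of_lt (l : Fin m → ℤ) (x : ℤ) {j : ℕ} (h : j < m) :
    rowExt (l ∷ʳ x) j = rowExt l j := by
  rw [rowExt_of_lt _ (h.trans m.lt_succ_self), rowExt_of_lt _ h]
  exact Fin.snoc_castSucc (α := fun _ => ℤ) x l ⟨j, h⟩

theorem rowExt_init (k : Fin (m + 1) → ℤ) {j : ℕ} (h : j < m) :
    rowExt (Fin.init k) j = rowExt k j := by
  rw [rowExt_of_lt _ (h.trans m.lt_succ_self), rowExt_of_lt _ h]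
  rfl

/-- The integers which condition 2 in the definition of `S`-triangles allows above and between
two adjacent entries `x` and `y`. -/
def betweenSet (x y : ℤ) : Finset ℤ :=
  if x ≤ y then Finset.Icc x y else Finset.Icc (y + 1) (x - 1)

theorem mem_betweenSet {x y z : ℤ} :
    z ∈ betweenSet x y ↔ (x ≤ y → x ≤ z ∧ z ≤ y) ∧ (x > y → x > z ∧ z > y) := by
  unfold betweenSet
  split_ifs <;> simp only [Finset.mem_Icc] <;> lia

theorem extSum_eq_sum_betweenSet (x y : ℤ) (g : ℤ → ℂ) :
    extSum x y g = ∑ z : betweenSet x y, (if y < x then -1 else 1) * g z := by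
  rw [Finset.sum_coe_sort (betweenSet x y) fun z => (if y < x then -1 else 1) * g z, extSum,
    betweenSet]
  rcases le_or_gt x y with h | h
  · simp [h, h.not_gt]
  · simp [h, h.not_ge]

variable {S : Finset (ℤ × ℤ)} {a a' b b' : ℕ → ℤ} {sp : Finset ℕ}

/-- The conditions in the definition of `S`-triangles on a row `b` of length `m` above a row `a` of
length `m + 1` (both indexed from `0`), where `sp` is the set of positions of the special entries
of `a`; the entry `b j` is placed above and between `a j` and `a (j + 1)`. -/
structure RowCond (S : Finset (ℤ × ℤ)) (m : ℕ) (a b : ℕ → ℤ) (sp : Finset ℕ) : Prop where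
  inner : ∀ c ∈ sp, 1 ≤ c ∧ c < m
  not_adjacent : ∀ c ∈ sp, c + 1 ∉ sp
  parents : ∀ c, c + 1 ∈ sp → ∃ s ∈ S, b c = a (c + 1) + s.1 ∧ b (c + 1) = a (c + 1) + s.2
  between : ∀ j < m, j ∉ sp → j + 1 ∉ sp → b j ∈ betweenSet (a j) (a (j + 1))

theorem RowCond.notMem_of_le (h : RowCond S m a b sp) {j : ℕ} (hj : m ≤ j) : j ∉ sp :=
  fun hmem => (h.inner j hmem).2.not_ge hj

theorem RowCond.congr (h : RowCond S m a b sp) (ha : ∀ j ≤ m, a j = a' j)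
    (hb : ∀ j < m, b j = b' j) : RowCond S m a' b' sp where
  inner := h.inner
  not_adjacent := h.not_adjacent
  parents c hc := by
    have hcm := (h.inner _ hc).2
    rw [← ha _ hcm.le, ← hb _ hcm, ← hb _ (c.lt_succ_self.trans hcm)]
    exact h.parents c hc
  between j hj hj₀ hj₁ := by
    rw [← ha _ hj.le, ← ha _ hj, ← hb _ hj]
    exact h.between j hj hj₀ hj₁

theorem rowCond_succ_iff (hm : m ∉ sp) :
    RowCond S (m + 1) a b sp ↔ RowCond S m a b sp ∧ b m ∈ betweenSet (a m) (a (m + 1)) := by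
  constructor
  · rintro ⟨inner, not_adjacent, parents, between⟩
    exact ⟨⟨by grind, not_adjacent, parents, by grind⟩, by grind⟩
  · rintro ⟨⟨inner, not_adjacent, parents, between⟩, hb⟩
    exact ⟨by grind, not_adjacent, parents, by grind⟩

theorem rowCond_insert_iff (hm : m + 1 ∉ sp) :
    RowCond S (m + 2) a b (insert (m + 1) sp) ↔
      RowCond S m a b sp ∧ ∃ s ∈ S, b m = a (m + 1) + s.1 ∧ b (m + 1) = a (m + 1) + s.2 := by
  constructor
  · rintro ⟨inner, not_adjacent, parents, between⟩
    simp only [Finset.mem_insert] at inner not_adjacent parents between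
    exact ⟨⟨by grind, by grind, by grind, by grind⟩, by grind⟩
  · rintro ⟨⟨inner, not_adjacent, parents, between⟩, hs⟩
    exact ⟨by grind, by grind, by grind, by grind⟩

variable (f : S → ℂ)

/-- The contribution to the weight of a special entry `a` with parents `b` and `c`, namely `f s`
for the `s` it is associated to. -/
def parentWeight (a b c : ℤ) : ℂ :=
  ∏ s : S, if b = a + s.1.1 ∧ c = a + s.1.2 then f s else 1

theorem parentWeight_add (a : ℤ) (s : S) : parentWeight f a (a + s.1.1) (a + s.1.2) = f s := by
  rw [parentWeight, Fintype.prod_eq_single s]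
  · simp only [and_self, if_true]
  · intro t hts
    simp only [add_right_inj, ← Prod.ext_iff, ← Subtype.ext_iff, hts.symm, if_false]

/-- The positions `j` of the inversions `(a j, a (j + 1))` in a row `a` of length `m + 1`. -/
def rowInversions (m : ℕ) (a : ℕ → ℤ) (sp : Finset ℕ) : Finset ℕ :=
  {j ∈ Finset.range m | j ∉ sp ∧ j + 1 ∉ sp ∧ a (j + 1) < a j}

theorem rowInversions_insert :
    rowInversions (m + 2) a (insert (m + 1) sp) = rowInversions m a sp := by
  ext j
  simp only [rowInversions, Finset.mem_filter, Finset.mem_range, Finset.mem_insert]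
  grind

/-- The contribution of the inversions and special entries of a row `a` of length `m + 1` to the
weight, where `b` is the row above it. -/
def rowWeight (m : ℕ) (a b : ℕ → ℤ) (sp : Finset ℕ) : ℂ :=
  (-1) ^ (rowInversions m a sp).card * ∏ c ∈ sp, parentWeight f (a c) (b (c - 1)) (b c)

theorem rowWeight_congr (hsp : ∀ c ∈ sp, c < m) (ha : ∀ j ≤ m, a j = a' j)
    (hb : ∀ j < m, b j = b' j) : rowWeight f m a b sp = rowWeight f m a' b' sp := by
  have hinv : rowInversions m a sp = rowInversions m a' sp := by
    ext j
    simp only [rowInversions, Finset.mem_filter, Finset.mem_range]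
    grind
  rw [rowWeight, rowWeight, hinv]
  congr 1
  refine Finset.prod_congr rfl fun c hc => ?_
  have hcm := hsp c hc
  rw [ha c hcm.le, hb c hcm, hb (c - 1) (by lia)]

theorem rowWeight_succ (hsp : ∀ c ∈ sp, c < m) :
    rowWeight f (m + 1) a b sp = (if a (m + 1) < a m then -1 else 1) * rowWeight f m a b sp := by
  have h₀ : m ∉ sp := fun h => (hsp m h).false
  have h₁ : m + 1 ∉ sp := fun h => by have := hsp _ h; lia
  unfold rowWeight rowInversions
  rw [Finset.range_add_one, Finset.filter_insert]
  simp only [h₀, h₁, not_false_eq_true, true_and]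
  split_ifs
  · rw [Finset.card_insert_of_notMem (by simp), pow_succ]
    ring
  · ring

theorem rowWeight_insert (hsp : ∀ c ∈ sp, c < m) (s : S) (h₁ : b m = a (m + 1) + s.1.1)
    (h₂ : b (m + 1) = a (m + 1) + s.1.2) :
    rowWeight f (m + 2) a b (insert (m + 1) sp) = f s * rowWeight f m a b sp := by
  have hm : m + 1 ∉ sp := fun h => by have := hsp _ h; lia
  rw [rowWeight, rowWeight, rowInversions_insert, Finset.prod_insert hm, Nat.add_sub_cancel,
    h₁, h₂, parentWeight_add, mul_left_comm]

end Rows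

/-- A row that may be placed above the row `k`, together with the positions of the special entries
of `k`. -/
@[ext]
structure RowChoice (S : Finset (ℤ × ℤ)) (m : ℕ) (k : Fin (m + 1) → ℤ) where
  row : Fin m → ℤ
  special : Finset ℕ
  cond : RowCond S m (rowExt k) (rowExt row) special

namespace RowChoice

variable {S : Finset (ℤ × ℤ)} {m : ℕ}

instance (k : Fin 1 → ℤ) : Unique (RowChoice S 0 k) where
  default := ⟨Fin.elim0, ∅, by constructor <;> simp⟩
  uniq x := RowChoice.ext (Subsingleton.elim _ _)
    (Finset.eq_empty_of_forall_notMem fun _ => x.cond.notMem_of_le (Nat.zero_le _))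

/-- Extends the upper row by an entry which is not a parent of a special entry. -/
def snoc {k : Fin (m + 2) → ℤ}
    (z : betweenSet (Fin.init k (Fin.last m)) (k (Fin.last (m + 1))))
    (x : RowChoice S m (Fin.init k)) : RowChoice S (m + 1) k where
  row := x.row ∷ʳ z
  special := x.special
  cond := by
    rw [rowCond_succ_iff (x.cond.notMem_of_le le_rfl), rowExt_snoc_self,
      rowExt_of_lt k (show m < m + 2 by lia), rowExt_of_lt k (show m + 1 < m + 2 by lia)]
    exact ⟨x.cond.congr (fun j hj => rowExt_init k (by lia))
      fun j hj => (rowExt_snoc_of_lt _ _ hj).symm, z.2⟩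

/-- Extends the upper row by the two parents of a new special entry. -/
def snocParents {k : Fin (m + 3) → ℤ} (s : S) (x : RowChoice S m (Fin.init (Fin.init k))) :
    RowChoice S (m + 2) k where
  row := x.row ∷ʳ (Fin.init k (Fin.last (m + 1)) + s.1.1) ∷ʳ
    (Fin.init k (Fin.last (m + 1)) + s.1.2)
  special := insert (m + 1) x.special
  cond := by
    rw [rowCond_insert_iff (x.cond.notMem_of_le m.le_succ), rowExt_snoc_self,
      rowExt_snoc_of_lt _ _ m.lt_succ_self, rowExt_snoc_self,
      rowExt_of_lt k (show m + 1 < m + 3 by lia)]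
    refine ⟨x.cond.congr (fun j hj => ?_) fun j hj => ?_, s, s.2, rfl, rfl⟩
    · rw [rowExt_init _ (by lia), rowExt_init _ (by lia)]
    · rw [rowExt_snoc_of_lt _ _ (by lia), rowExt_snoc_of_lt _ _ hj]

theorem uncurry_snoc_injective (k : Fin (m + 2) → ℤ) :
    Function.Injective (Function.uncurry (snoc (S := S) (k := k))) := by
  rintro ⟨z, x⟩ ⟨z', x'⟩ h
  simp only [Function.uncurry_apply_pair, snoc, RowChoice.mk.injEq, Fin.snoc_inj] at h
  exact Prod.ext (Subtype.ext h.1.2) (RowChoice.ext h.1.1 h.2)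

theorem uncurry_snocParents_injective (k : Fin (m + 3) → ℤ) :
    Function.Injective (Function.uncurry (snocParents (S := S) (k := k))) := by
  rintro ⟨s, x⟩ ⟨s', x'⟩ h
  simp only [Function.uncurry_apply_pair, snocParents, RowChoice.mk.injEq, Fin.snoc_inj,
    add_right_inj] at h
  refine Prod.ext (Subtype.ext (Prod.ext h.1.1.2 h.1.2)) (RowChoice.ext h.1.1.1 ?_)
  rw [← Finset.erase_insert (x.cond.notMem_of_le m.le_succ), h.2,
    Finset.erase_insert (x'.cond.notMem_of_le m.le_succ)]

theorem exists_eq_snoc {k : Fin (m + 2) → ℤ} (x : RowChoice S (m + 1) k) (hx : m ∉ x.special) :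
    ∃ z x', x = snoc z x' := by
  obtain ⟨l, sp, h⟩ := x
  obtain ⟨hinit, hlast⟩ := (rowCond_succ_iff hx).mp h
  rw [rowExt_of_lt l m.lt_succ_self, rowExt_of_lt k (show m < m + 2 by lia),
    rowExt_of_lt k (show m + 1 < m + 2 by lia)] at hlast
  refine ⟨⟨l (Fin.last m), hlast⟩, ⟨Fin.init l, sp, hinit.congr
    (fun j hj => (rowExt_init k (by lia)).symm) fun j hj => (rowExt_init l hj).symm⟩, ?_⟩
  simp only [snoc, Fin.snoc_init_self]

theorem exists_eq_snocParents {k : Fin (m + 3) → ℤ} (x : RowChoice S (m + 2) k)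
    (hx : m + 1 ∈ x.special) : ∃ s x', x = snocParents s x' := by
  obtain ⟨l, sp, h⟩ := x
  obtain ⟨sp, hsp, rfl⟩ : ∃ sp', m + 1 ∉ sp' ∧ insert (m + 1) sp' = sp :=
    ⟨sp.erase (m + 1), Finset.notMem_erase _ _, Finset.insert_erase hx⟩
  obtain ⟨hinit, s, hs, h₁, h₂⟩ := (rowCond_insert_iff hsp).mp h
  rw [rowExt_of_lt k (show m + 1 < m + 3 by lia)] at h₁ h₂
  rw [rowExt_of_lt l (show m < m + 2 by lia)] at h₁
  rw [rowExt_of_lt l (show m + 1 < m + 2 by lia)] at h₂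
  refine ⟨⟨s, hs⟩, ⟨Fin.init (Fin.init l), sp, hinit.congr (fun j hj => ?_) fun j hj => ?_⟩,
    RowChoice.ext ?_ rfl⟩
  · rw [rowExt_init _ (by lia), rowExt_init _ (by lia)]
  · rw [rowExt_init _ (by lia), rowExt_init _ (by lia)]
  · change l = Fin.init (Fin.init l) ∷ʳ _ ∷ʳ _
    have e₁ : Fin.init k (Fin.last (m + 1)) + s.1 = Fin.init l (Fin.last m) := h₁.symm
    have e₂ : Fin.init k (Fin.last (m + 1)) + s.2 = l (Fin.last (m + 1)) := h₂.symm
    rw [e₁, e₂, Fin.snoc_init_self, Fin.snoc_init_self]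

theorem uncurry_snoc_bijective (k : Fin 2 → ℤ) :
    Function.Bijective (Function.uncurry (snoc (S := S) (k := k))) := by
  refine ⟨uncurry_snoc_injective k, fun x => ?_⟩
  obtain ⟨z, x', rfl⟩ := x.exists_eq_snoc fun h => by simpa using x.cond.inner 0 h
  exact ⟨(z, x'), rfl⟩

theorem sumElim_snoc_snocParents_bijective (k : Fin (m + 3) → ℤ) :
    Function.Bijective (Sum.elim (Function.uncurry (snoc (S := S) (k := k)))
      (Function.uncurry snocParents)) := by
  refine ⟨(uncurry_snoc_injective k).sumElim (uncurry_snocParents_injective k) fun p q h => ?_,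
    fun x => ?_⟩
  · have hspecial : p.2.special = insert (m + 1) q.2.special := congrArg RowChoice.special h
    refine p.2.cond.notMem_of_le le_rfl ?_
    rw [hspecial]
    exact Finset.mem_insert_self _ _
  · by_cases hx : m + 1 ∈ x.special
    · obtain ⟨s, x', rfl⟩ := x.exists_eq_snocParents hx
      exact ⟨Sum.inr (s, x'), rfl⟩
    · obtain ⟨z, x', rfl⟩ := x.exists_eq_snoc hx
      exact ⟨Sum.inl (z, x'), rfl⟩

theorem finite (S : Finset (ℤ × ℤ)) : ∀ (m : ℕ) (k : Fin (m + 1) → ℤ), Finite (RowChoice S m k)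
  | 0, _ => inferInstance
  | 1, k => Finite.of_surjective _ (uncurry_snoc_bijective k).surjective
  | m + 2, k =>
    have := finite S (m + 1) (Fin.init k)
    have := finite S m (Fin.init (Fin.init k))
    Finite.of_surjective _ (sumElim_snoc_snocParents_bijective k).surjective

instance (k : Fin (m + 1) → ℤ) : Fintype (RowChoice S m k) :=
  have := finite S m k
  Fintype.ofFinite _

/-- The contribution to the weight of the row `k` below the chosen one. -/
def weight (f : S → ℂ) {k : Fin (m + 1) → ℤ} (x : RowChoice S m k) : ℂ :=
  rowWeight f m (rowExt k) (rowExt x.row) x.special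

variable (f : S → ℂ)

theorem weight_snoc {k : Fin (m + 2) → ℤ}
    (z : betweenSet (Fin.init k (Fin.last m)) (k (Fin.last (m + 1))))
    (x : RowChoice S m (Fin.init k)) :
    (snoc (k := k) z x).weight f =
      (if k (Fin.last (m + 1)) < Fin.init k (Fin.last m) then -1 else 1) * x.weight f := by
  have hsp := fun c hc => (x.cond.inner c hc).2
  rw [weight, weight, snoc, rowWeight_succ f hsp, rowExt_of_lt k (show m < m + 2 by lia),
    rowExt_of_lt k (show m + 1 < m + 2 by lia)]
  exact congrArg _ (rowWeight_congr f hsp (fun j hj => (rowExt_init k (by lia)).symm)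
    fun j hj => rowExt_snoc_of_lt _ _ hj)

theorem weight_snocParents {k : Fin (m + 3) → ℤ} (s : S)
    (x : RowChoice S m (Fin.init (Fin.init k))) :
    (snocParents (k := k) s x).weight f = f s * x.weight f := by
  have hsp := fun c hc => (x.cond.inner c hc).2
  have hk : rowExt k (m + 1) = Fin.init k (Fin.last (m + 1)) :=
    rowExt_of_lt k (show m + 1 < m + 3 by lia)
  rw [weight, weight, snocParents, rowWeight_insert f hsp s]
  · refine congrArg _ (rowWeight_congr f hsp (fun j hj => ?_) fun j hj => ?_)
    · rw [rowExt_init _ (by lia), rowExt_init _ (by lia)]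
    · rw [rowExt_snoc_of_lt _ _ (by lia), rowExt_snoc_of_lt _ _ hj]
  · rw [rowExt_snoc_of_lt _ _ m.lt_succ_self, rowExt_snoc_self, hk]
  · rw [rowExt_snoc_self, hk]

theorem sum_weight_mul : ∀ (m : ℕ) (k : Fin (m + 1) → ℤ) (A : (Fin m → ℤ) → ℂ),
    ∑ x : RowChoice S m k, x.weight f * A x.row = sumOp S f m k A
  | 0, k, A => by
    rw [Fintype.sum_unique]
    simp [weight, rowWeight, rowInversions, default, sumOp]
  | 1, k, A => by
    rw [sumOp, extSum_eq_sum_betweenSet, ← (uncurry_snoc_bijective k).sum_comp,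
      Fintype.sum_prod_type]
    refine Finset.sum_congr rfl fun z _ => ?_
    simp only [Function.uncurry_apply_pair, weight_snoc, mul_assoc, ← Finset.mul_sum]
    exact congrArg _ (sum_weight_mul 0 _ fun l => A (l ∷ʳ z))
  | m + 2, k, A => by
    rw [sumOp, extSum_eq_sum_betweenSet, ← (sumElim_snoc_snocParents_bijective k).sum_comp,
      Fintype.sum_sum_type, Fintype.sum_prod_type, Fintype.sum_prod_type_right]
    simp only [Sum.elim_inl, Sum.elim_inr, Function.uncurry_apply_pair, weight_snoc,
      weight_snocParents]
    congr 1
    · refine Finset.sum_congr rfl fun z _ => ?_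
      simp only [mul_assoc, ← Finset.mul_sum]
      exact congrArg _ (sum_weight_mul (m + 1) _ fun l => A (l ∷ʳ z))
    · rw [← sum_weight_mul m]
      refine Finset.sum_congr rfl fun x _ => ?_
      rw [Finset.mul_sum]
      exact Finset.sum_congr rfl fun s _ => by rw [snocParents]; ring

end RowChoice

section Positions

theorem isParent_succ_iff {special : Finset (ℕ × ℕ)} {i j : ℕ} :
    IsParent special (i + 1) (j + 1) ↔ (i, j) ∈ special ∨ (i, j + 1) ∈ special := by
  unfold IsParent
  simp only [Prod.mk.injEq, add_left_inj, Prod.exists]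
  grind

/-- The position in a triangle of the `c`-th entry of the bottom row, where `c` is counted
from `0`. -/
def bottomPos : ℕ ↪ ℕ × ℕ := ⟨fun c => (1, c + 1), fun _ _ h => by simpa using h⟩

/-- The position of an entry after a new bottom row has been put below the triangle. -/
def raisePos : ℕ × ℕ ↪ ℕ × ℕ :=
  ⟨fun p => (p.1 + 1, p.2 + 1), fun _ _ h => by simpa [Prod.ext_iff] using h⟩

theorem bottomPos_apply (c : ℕ) : bottomPos c = (1, c + 1) := rfl

theorem raisePos_apply (p : ℕ × ℕ) : raisePos p = (p.1 + 1, p.2 + 1) := rfl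

/-- The set of positions consisting of `A` in a new bottom row and of `B` in the triangle
above it. -/
def gluePositions (A : Finset ℕ) (B : Finset (ℕ × ℕ)) : Finset (ℕ × ℕ) :=
  A.map bottomPos ∪ B.map raisePos

/-- The part of a set of positions which lies above the bottom row, as positions in the triangle
without its bottom row. -/
def tailPositions (C : Finset (ℕ × ℕ)) : Finset (ℕ × ℕ) :=
  {p ∈ C.preimage raisePos raisePos.injective.injOn | 1 ≤ p.1}

variable {A : Finset ℕ} {B C : Finset (ℕ × ℕ)} {i j : ℕ}

theorem mem_preimage_bottomPos {c : ℕ} :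
    c ∈ C.preimage bottomPos bottomPos.injective.injOn ↔ (1, c + 1) ∈ C :=
  Finset.mem_preimage

theorem mem_gluePositions_raise : (i + 2, j + 1) ∈ gluePositions A B ↔ (i + 1, j) ∈ B := by
  simp [gluePositions, bottomPos_apply, raisePos_apply]

theorem mem_tailPositions : (i, j) ∈ tailPositions C ↔ 1 ≤ i ∧ (i + 1, j + 1) ∈ C := by
  simp [tailPositions, raisePos_apply, and_comm]

theorem mem_gluePositions_bottom (hB : ∀ p ∈ B, 1 ≤ p.1) :
    (1, j + 1) ∈ gluePositions A B ↔ j ∈ A := by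
  have h₀ : (0, j) ∉ B := fun h => by simpa using hB _ h
  simpa [gluePositions, bottomPos_apply, raisePos_apply] using fun h => absurd h h₀

theorem gluePositions_cases (hB : ∀ p ∈ B, 1 ≤ p.1)
    (hij : (i, j) ∈ gluePositions A B) :
    (∃ c ∈ A, i = 1 ∧ j = c + 1) ∨ ∃ i' j', (i' + 1, j') ∈ B ∧ i = i' + 2 ∧ j = j' + 1 := by
  simp only [gluePositions, Finset.mem_union, Finset.mem_map] at hij
  rcases hij with ⟨c, hc, ⟨⟩⟩ | ⟨⟨i, j⟩, hB', ⟨⟩⟩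
  · exact Or.inl ⟨c, hc, rfl, rfl⟩
  · obtain ⟨i, rfl⟩ := Nat.exists_eq_add_of_le' (hB _ hB')
    exact Or.inr ⟨i, j, hB', rfl, rfl⟩

theorem eq_gluePositions (hB : ∀ p ∈ B, 1 ≤ p.1) (hC : ∀ p ∈ C, 1 ≤ p.1 ∧ 1 ≤ p.2)
    (bottom : ∀ j, (1, j + 1) ∈ C ↔ j ∈ A) (raise : ∀ i j, (i + 2, j + 1) ∈ C ↔ (i + 1, j) ∈ B) :
    C = gluePositions A B := by
  ext ⟨i, j⟩
  refine ⟨fun h => ?_, fun h => ?_⟩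
  · obtain ⟨j, rfl⟩ := Nat.exists_eq_add_of_le' (hC _ h).2
    rcases i with _ | _ | i
    · exact absurd (hC _ h).1 (by simp)
    · exact (mem_gluePositions_bottom hB).mpr ((bottom j).mp h)
    · exact mem_gluePositions_raise.mpr ((raise i j).mp h)
  · obtain ⟨c, hc, rfl, rfl⟩ | ⟨i, j, hij, rfl, rfl⟩ := gluePositions_cases hB h
    · exact (bottom c).mpr hc
    · exact (raise i j).mpr hij

theorem disjoint_map_bottomPos_map_raisePos (hB : ∀ p ∈ B, 1 ≤ p.1) :
    Disjoint (A.map bottomPos) (B.map raisePos) := by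
  simp only [Finset.disjoint_left, Finset.mem_map, not_exists, not_and]
  rintro _ ⟨c, -, rfl⟩ ⟨i, j⟩ hp h
  have hi := hB _ hp
  simp only [raisePos_apply, bottomPos_apply, Prod.mk.injEq] at h
  lia

theorem card_gluePositions (hB : ∀ p ∈ B, 1 ≤ p.1) :
    (gluePositions A B).card = A.card + B.card := by
  rw [gluePositions, Finset.card_union_of_disjoint (disjoint_map_bottomPos_map_raisePos hB),
    Finset.card_map, Finset.card_map]

theorem prod_gluePositions (hB : ∀ p ∈ B, 1 ≤ p.1) (g : ℕ × ℕ → ℂ) :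
    ∏ p ∈ gluePositions A B, g p =
      (∏ c ∈ A, g (1, c + 1)) * ∏ p ∈ B, g (p.1 + 1, p.2 + 1) := by
  rw [gluePositions, Finset.prod_union (disjoint_map_bottomPos_map_raisePos hB), Finset.prod_map,
    Finset.prod_map]
  rfl

end Positions

/-- The array obtained by putting the row `a` below the array `e`. -/
def glueEntry (a : ℕ → ℤ) (e : ℕ → ℕ → ℤ) : ℕ → ℕ → ℤ
  | 1, j + 1 => a j
  | i + 2, j + 1 => e (i + 1) j
  | _, _ => 0

namespace STriangle

variable {S : Finset (ℤ × ℤ)} {n m : ℕ}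

theorem one_le_of_mem_special (T : STriangle S n) : ∀ p ∈ T.special, 1 ≤ p.1 :=
  fun p hp => (T.special_inner p.1 p.2 hp).1

theorem entry_zero_left (T : STriangle S n) (j : ℕ) : T.entry 0 j = 0 :=
  T.entry_outside _ _ (by lia)

theorem HasBottomRow.entry_eq {T : STriangle S n} {k : Fin n → ℤ} (h : T.HasBottomRow k) (j : ℕ) :
    T.entry 1 (j + 1) = rowExt k j := by
  rcases lt_or_ge j n with hj | hj
  · rw [rowExt_of_lt k hj, ← h ⟨j, hj⟩]
  · rw [rowExt_of_le k hj, T.entry_outside _ _ (by lia)]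

theorem entry_mem_betweenSet (T : STriangle S n) {i j : ℕ} (hi : 1 ≤ i) (hij : i ≤ j) (hj : j < n)
    (h : ¬ IsParent T.special (i + 1) (j + 1)) :
    T.entry (i + 1) (j + 1) ∈ betweenSet (T.entry i j) (T.entry i (j + 1)) :=
  mem_betweenSet.mpr ⟨T.between_of_le i j hi hij hj h, T.between_of_gt i j hi hij hj h⟩

section Glue

variable {k : Fin (m + 1) → ℤ} (x : RowChoice S m k) (T : STriangle S m)
  (hT : T.HasBottomRow x.row)

include hT in
theorem glueEntry_mem_betweenSet {i j : ℕ} (hi : 1 ≤ i) (hij : i ≤ j) (hj : j < m + 1)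
    (h : ¬ IsParent (gluePositions x.special T.special) (i + 1) (j + 1)) :
    glueEntry (rowExt k) T.entry (i + 1) (j + 1) ∈
      betweenSet (glueEntry (rowExt k) T.entry i j) (glueEntry (rowExt k) T.entry i (j + 1)) := by
  obtain ⟨j, rfl⟩ := Nat.exists_eq_add_of_le' (hi.trans hij)
  rw [isParent_succ_iff, not_or] at h
  rcases i with _ | _ | i
  · exact absurd hi (by simp)
  · rw [mem_gluePositions_bottom T.one_le_of_mem_special,
      mem_gluePositions_bottom T.one_le_of_mem_special] at h
    have hbetween := x.cond.between j (by lia) h.1 h.2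
    rwa [← hT.entry_eq] at hbetween
  · rw [mem_gluePositions_raise, mem_gluePositions_raise] at h
    exact T.entry_mem_betweenSet (Nat.le_add_left 1 i) (by lia) (by lia)
      (by rwa [isParent_succ_iff, not_or])

/-- The triangle obtained by putting the row `k` below a triangle. -/
def glue : STriangle S (m + 1) where
  entry := glueEntry (rowExt k) T.entry
  entry_outside i j hij := by
    rcases i with _ | _ | i <;> rcases j with _ | j <;> try rfl
    · exact rowExt_of_le k (by lia)
    · exact T.entry_outside _ _ (by lia)
  special := gluePositions x.special T.special
  special_inner i j hij := by
    obtain ⟨c, hc, rfl, rfl⟩ | ⟨i, j, hmem, rfl, rfl⟩ :=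
      gluePositions_cases T.one_le_of_mem_special hij
    · have := x.cond.inner c hc
      lia
    · have := T.special_inner _ _ hmem
      lia
  special_not_adjacent i j hij := by
    obtain ⟨c, hc, rfl, rfl⟩ | ⟨i, j, hmem, rfl, rfl⟩ :=
      gluePositions_cases T.one_le_of_mem_special hij
    · rw [mem_gluePositions_bottom T.one_le_of_mem_special]
      exact x.cond.not_adjacent c hc
    · rw [mem_gluePositions_raise]
      exact T.special_not_adjacent _ _ hmem
  special_parents i j hij := by
    obtain ⟨c, hc, rfl, rfl⟩ | ⟨i, j, hmem, rfl, rfl⟩ :=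
      gluePositions_cases T.one_le_of_mem_special hij
    · obtain ⟨c, rfl⟩ := Nat.exists_eq_add_of_le' (x.cond.inner c hc).1
      obtain ⟨s, hs, h₁, h₂⟩ := x.cond.parents _ hc
      rw [← hT.entry_eq] at h₁ h₂
      exact ⟨s, hs, Prod.ext h₁ h₂⟩
    · exact T.special_parents _ _ hmem
  between_of_le _ _ hi hij hj h :=
    (mem_betweenSet.mp (glueEntry_mem_betweenSet x T hT hi hij hj h)).1
  between_of_gt _ _ hi hij hj h :=
    (mem_betweenSet.mp (glueEntry_mem_betweenSet x T hT hi hij hj h)).2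

theorem glue_hasBottomRow : (glue x T hT).HasBottomRow k := fun j => rowExt_val k j

end Glue

section Tail

theorem tail_entry_mem_betweenSet (T : STriangle S (m + 1)) {i j : ℕ} (hi : 1 ≤ i) (hij : i ≤ j)
    (hj : j < m) (h : ¬ IsParent (tailPositions T.special) (i + 1) (j + 1)) :
    T.entry (i + 2) (j + 2) ∈ betweenSet (T.entry (i + 1) (j + 1)) (T.entry (i + 1) (j + 2)) := by
  refine T.entry_mem_betweenSet (Nat.le_add_left 1 i) (by lia) (by lia) ?_
  simpa only [isParent_succ_iff, mem_tailPositions, hi, true_and] using h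

/-- The triangle without its bottom row. -/
def tail (T : STriangle S (m + 1)) : STriangle S m where
  entry
    | 0, _ => 0
    | i + 1, j => T.entry (i + 2) (j + 1)
  entry_outside i j hij := by
    rcases i with _ | i
    · rfl
    · exact T.entry_outside _ _ (by lia)
  special := tailPositions T.special
  special_inner i j hij := by
    rw [mem_tailPositions] at hij
    have := T.special_inner _ _ hij.2
    lia
  special_not_adjacent i j hij := by
    rw [mem_tailPositions] at hij ⊢
    exact fun h => T.special_not_adjacent _ _ hij.2 h.2
  special_parents i j hij := by
    rw [mem_tailPositions] at hij
    obtain ⟨i, rfl⟩ := Nat.exists_eq_add_of_le' hij.1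
    exact T.special_parents _ _ hij.2
  between_of_le i j hi hij hj h := by
    obtain ⟨i, rfl⟩ := Nat.exists_eq_add_of_le' hi
    exact (mem_betweenSet.mp (T.tail_entry_mem_betweenSet hi hij hj h)).1
  between_of_gt i j hi hij hj h := by
    obtain ⟨i, rfl⟩ := Nat.exists_eq_add_of_le' hi
    exact (mem_betweenSet.mp (T.tail_entry_mem_betweenSet hi hij hj h)).2

/-- The second row from the bottom. -/
def secondRow (T : STriangle S (m + 1)) : Fin m → ℤ := fun j => T.entry 2 (j + 2)

theorem tail_hasBottomRow (T : STriangle S (m + 1)) : T.tail.HasBottomRow T.secondRow :=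
  fun _ => rfl

theorem rowExt_secondRow (T : STriangle S (m + 1)) (j : ℕ) :
    rowExt T.secondRow j = T.entry 2 (j + 2) :=
  (T.tail_hasBottomRow.entry_eq j).symm

variable (T : STriangle S (m + 1)) {k : Fin (m + 1) → ℤ} (hT : T.HasBottomRow k)

/-- The second row of a triangle and the special entries in its bottom row `k`, as one of the
choices for a row above `k`. -/
def bottomChoice : RowChoice S m k where
  row := T.secondRow
  special := T.special.preimage bottomPos bottomPos.injective.injOn
  cond :=
    { inner := fun c hc => by
        have := T.special_inner _ _ (mem_preimage_bottomPos.mp hc)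
        lia
      not_adjacent := fun c hc => by
        rw [mem_preimage_bottomPos] at hc ⊢
        exact T.special_not_adjacent _ _ hc
      parents := fun c hc => by
        obtain ⟨s, hs, h⟩ := T.special_parents _ _ (mem_preimage_bottomPos.mp hc)
        refine ⟨s, hs, ?_⟩
        rw [rowExt_secondRow, rowExt_secondRow, ← hT.entry_eq]
        exact Prod.ext_iff.mp h
      between := fun j hj hj₀ hj₁ => by
        rw [mem_preimage_bottomPos] at hj₀ hj₁
        rw [rowExt_secondRow, ← hT.entry_eq, ← hT.entry_eq]
        refine T.entry_mem_betweenSet le_rfl (Nat.le_add_left 1 j) (by lia) ?_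
        rw [isParent_succ_iff, not_or]
        exact ⟨hj₀, hj₁⟩ }

end Tail

section Bijection

theorem glue_bottomChoice_tail (T : STriangle S (m + 1)) {k : Fin (m + 1) → ℤ}
    (hT : T.HasBottomRow k) : glue (T.bottomChoice hT) T.tail T.tail_hasBottomRow = T := by
  refine STriangle.ext (funext₂ fun i j => ?_) (Eq.symm ?_)
  · change glueEntry _ _ i j = _
    rcases i with _ | i
    · exact (T.entry_zero_left j).symm
    rcases j with _ | j
    · cases i <;> exact (T.entry_outside _ _ (by lia)).symm
    rcases i with _ | i
    · exact (hT.entry_eq j).symm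
    · rfl
  · refine eq_gluePositions T.tail.one_le_of_mem_special (fun p hp => ?_)
      (fun j => mem_preimage_bottomPos.symm) fun i j => ?_
    · have := T.special_inner _ _ hp
      lia
    · exact (mem_tailPositions.trans (and_iff_right (Nat.le_add_left 1 i))).symm

variable {k : Fin (m + 1) → ℤ} (x : RowChoice S m k) (T : STriangle S m)
  (hT : T.HasBottomRow x.row)

theorem tail_glue : (glue x T hT).tail = T := by
  refine STriangle.ext (funext₂ fun i j => ?_) (Finset.ext fun ⟨i, j⟩ => ?_)
  · rcases i with _ | i
    · exact (T.entry_zero_left j).symm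
    · rfl
  · refine mem_tailPositions.trans ?_
    rcases i with _ | i
    · exact iff_of_false (fun h => absurd h.1 (by simp))
        fun h => absurd (T.one_le_of_mem_special _ h) (by simp)
    · exact (and_iff_right (Nat.le_add_left 1 i)).trans mem_gluePositions_raise

theorem bottomChoice_glue : (glue x T hT).bottomChoice (glue_hasBottomRow x T hT) = x :=
  RowChoice.ext (funext hT) <| Finset.ext fun _ =>
    mem_preimage_bottomPos.trans (mem_gluePositions_bottom T.one_le_of_mem_special)

theorem glue_bijective (k : Fin (m + 1) → ℤ) :
    Function.Bijective (fun p => ⟨glue p.1 p.2.1 p.2.2, glue_hasBottomRow _ _ _⟩ :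
      (Σ x : RowChoice S m k, {T : STriangle S m // T.HasBottomRow x.row}) →
        {T : STriangle S (m + 1) // T.HasBottomRow k}) := by
  constructor
  · rintro ⟨x, T, hT⟩ ⟨x', T', hT'⟩ h
    have hglue : glue x T hT = glue x' T' hT' := congrArg Subtype.val h
    obtain rfl : x = x' := by
      rw [← bottomChoice_glue x T hT, ← bottomChoice_glue x' T' hT']
      simp only [hglue]
    obtain rfl : T = T' := by rw [← tail_glue x T hT, hglue, tail_glue]
    rfl
  · rintro ⟨T, hT⟩
    exact ⟨⟨T.bottomChoice hT, T.tail, T.tail_hasBottomRow⟩,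
      Subtype.ext (T.glue_bottomChoice_tail hT)⟩

end Bijection

section Weight

theorem mem_inversions {T : STriangle S n} {i j : ℕ} : (i, j) ∈ T.inversions ↔
    1 ≤ i ∧ i ≤ j ∧ j < n ∧ ¬ IsParent T.special (i + 1) (j + 1) ∧
      T.entry i (j + 1) < T.entry i j := by
  simp only [inversions, Finset.mem_filter, Finset.mem_product, Finset.mem_Icc, gt_iff_lt]
  grind

theorem one_le_of_mem_inversions (T : STriangle S n) : ∀ p ∈ T.inversions, 1 ≤ p.1 :=
  fun _ hp => (mem_inversions.mp hp).1

theorem weight_eq_prod_parentWeight (f : S → ℂ) (T : STriangle S n) :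
    T.weight f = (-1) ^ T.inversions.card * ∏ p ∈ T.special,
      parentWeight f (T.entry p.1 p.2) (T.entry (p.1 + 1) p.2) (T.entry (p.1 + 1) (p.2 + 1)) := by
  simp only [weight, parentWeight]
  rw [Finset.prod_comm]
  congr 1
  refine Finset.prod_congr rfl fun s _ => ?_
  rw [← Finset.prod_filter, Finset.prod_const]
  simp only [specialAssoc, Prod.mk.injEq]

variable {k : Fin (m + 1) → ℤ} (x : RowChoice S m k) (T : STriangle S m)
  (hT : T.HasBottomRow x.row)

theorem inversions_glue : (glue x T hT).inversions =
    gluePositions (rowInversions m (rowExt k) x.special) T.inversions := by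
  refine eq_gluePositions T.one_le_of_mem_inversions (fun p hp => ?_) (fun j => ?_) fun i j => ?_
  · have := mem_inversions.mp hp
    lia
  · have hspecial (c : ℕ) : (1, c + 1) ∈ (glue x T hT).special ↔ c ∈ x.special :=
      mem_gluePositions_bottom T.one_le_of_mem_special
    rw [mem_inversions, isParent_succ_iff, hspecial, hspecial,
      (glue_hasBottomRow x T hT).entry_eq, (glue_hasBottomRow x T hT).entry_eq, rowInversions,
      Finset.mem_filter, Finset.mem_range]
    grind
  · have hspecial (c : ℕ) : (i + 2, c + 1) ∈ (glue x T hT).special ↔ (i + 1, c) ∈ T.special :=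
      mem_gluePositions_raise
    have hentry (c : ℕ) : (glue x T hT).entry (i + 2) (c + 1) = T.entry (i + 1) c := rfl
    rw [mem_inversions, mem_inversions, isParent_succ_iff, isParent_succ_iff, hspecial, hspecial,
      hentry, hentry]
    grind

theorem weight_glue (f : S → ℂ) : (glue x T hT).weight f = x.weight f * T.weight f := by
  have hbottom : ∀ c ∈ x.special, parentWeight f ((glue x T hT).entry 1 (c + 1))
      ((glue x T hT).entry 2 (c + 1)) ((glue x T hT).entry 2 (c + 2)) =
      parentWeight f (rowExt k c) (rowExt x.row (c - 1)) (rowExt x.row c) := fun c hc => by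
    obtain ⟨c, rfl⟩ := Nat.exists_eq_add_of_le' (x.cond.inner c hc).1
    rw [← hT.entry_eq, ← hT.entry_eq]
    rfl
  have hraise : ∀ p ∈ T.special, parentWeight f ((glue x T hT).entry (p.1 + 1) (p.2 + 1))
      ((glue x T hT).entry (p.1 + 2) (p.2 + 1)) ((glue x T hT).entry (p.1 + 2) (p.2 + 2)) =
      parentWeight f (T.entry p.1 p.2) (T.entry (p.1 + 1) p.2)
        (T.entry (p.1 + 1) (p.2 + 1)) := fun ⟨i, j⟩ hp => by
    obtain ⟨i, rfl⟩ := Nat.exists_eq_add_of_le' (T.one_le_of_mem_special _ hp)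
    rfl
  rw [weight_eq_prod_parentWeight, weight_eq_prod_parentWeight, inversions_glue,
    card_gluePositions T.one_le_of_mem_inversions,
    show (glue x T hT).special = gluePositions x.special T.special from rfl,
    prod_gluePositions T.one_le_of_mem_special, Finset.prod_congr rfl hbottom,
    Finset.prod_congr rfl hraise, RowChoice.weight, rowWeight]
  ring

end Weight

instance (k : Fin 0 → ℤ) : Unique {T : STriangle S 0 // T.HasBottomRow k} where
  default := ⟨⟨fun _ _ => 0, fun _ _ _ => rfl, ∅, by simp, by simp, by simp,
    fun _ _ _ _ h => absurd h (Nat.not_lt_zero _),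
    fun _ _ _ _ h => absurd h (Nat.not_lt_zero _)⟩, fun j => j.elim0⟩
  uniq T := by
    refine Subtype.ext (STriangle.ext (funext₂ fun i j => T.1.entry_outside _ _ (by lia)) ?_)
    refine Finset.eq_empty_of_forall_notMem fun p hp => ?_
    have := T.1.special_inner _ _ hp
    lia

theorem finite_subtype_hasBottomRow (S : Finset (ℤ × ℤ)) :
    ∀ (n : ℕ) (k : Fin n → ℤ), Finite {T : STriangle S n // T.HasBottomRow k}
  | 0, _ => inferInstance
  | m + 1, k =>
    have := finite_subtype_hasBottomRow S m
    Finite.of_surjective _ (glue_bijective k).surjective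

instance (k : Fin n → ℤ) : Fintype {T : STriangle S n // T.HasBottomRow k} :=
  have := finite_subtype_hasBottomRow S n k
  Fintype.ofFinite _

theorem sum_weight (f : S → ℂ) : ∀ (n : ℕ) (k : Fin n → ℤ),
    ∑ T : {T : STriangle S n // T.HasBottomRow k}, T.1.weight f = alpha S f n k
  | 0, k => by
    rw [Fintype.sum_unique, alpha, weight_eq_prod_parentWeight]
    simp [default, inversions]
  | m + 1, k => by
    rw [← (glue_bijective k).sum_comp, Fintype.sum_sigma, alpha, ← RowChoice.sum_weight_mul]
    refine Finset.sum_congr rfl fun x _ => ?_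
    rw [← sum_weight f m, Finset.mul_sum]
    exact Finset.sum_congr rfl fun T _ => weight_glue x T.1 T.2 f

end STriangle

theorem finite_hasBottomRow (S : Finset (ℤ × ℤ)) {n : ℕ} (k : Fin n → ℤ) :
    {T : STriangle S n | T.HasBottomRow k}.Finite :=
  STriangle.finite_subtype_hasBottomRow S n k

theorem alpha_eq_weightedCount (S : Finset (ℤ × ℤ)) (f : S → ℂ) {n : ℕ} (k : Fin n → ℤ) :
    alpha S f n k = weightedCount S f n k := by
  rw [← STriangle.sum_weight, weightedCount, ← finsum_eq_sum_of_fintype]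
  exact finsum_set_coe_eq_finsum_mem {T : STriangle S n | T.HasBottomRow k}

theorem exists_eq_laurentOf (s : Laurent₂) :
    ∃ (S : Finset (ℤ × ℤ)) (f : S → ℂ), s = laurentOf S f := by
  refine ⟨s.coeff.support.image Prod.swap, fun p => - s.coeff p.1.swap, ?_⟩
  rw [laurentOf, Finset.sum_coe_sort (s.coeff.support.image Prod.swap)
    (fun p => AddMonoidAlgebra.single (p.2, p.1) (- s.coeff p.swap)),
    Finset.sum_image Prod.swap_injective.injOn, ← Finset.sum_neg_distrib]
  conv_lhs => rw [← AddMonoidAlgebra.sum_coeff_single s]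
  simp [Finsupp.sum]

end OperatorFormula

end

open OperatorFormula in
theorem mainTheorem4 (n : ℕ) (hn : 1 ≤ n) :
    -- the interpretation for every Laurent polynomial `s(X, Y)`
    (∀ s : Laurent₂,
      (∃ (S : Finset (ℤ × ℤ)) (f : S → ℂ), s = laurentOf S f) ∧
      ∀ (S : Finset (ℤ × ℤ)) (f : S → ℂ), s = laurentOf S f → ∀ k : Fin n → ℤ,
        {T : STriangle S n | T.HasBottomRow k}.Finite ∧
        alpha S f n k = weightedCount S f n k ∧
        prodOperator n (Y + (X - 1) * (Y - 1) * s) (gtProduct n) k = weightedCount S f n k) ∧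
    -- the operator formula for monotone triangles, for all bottom rows
    (∀ k : Fin n → ℤ,
      prodOperator n (1 - X + X * Y) (gtProduct n) k =
        weightedCount {((0 : ℤ), (0 : ℤ))} (fun _ => -1) n k) := by
  refine ⟨fun s => ⟨exists_eq_laurentOf s, ?_⟩, fun k => ?_⟩
  · rintro S f rfl k
    refine ⟨finite_hasBottomRow S k, alpha_eq_weightedCount S f k, ?_⟩
    rw [← alpha_eq_weightedCount, ← prodOperator_gtProduct_eq_alpha]
  · have hone : (1 : Laurent₂) = laurentOf {((0 : ℤ), (0 : ℤ))} (fun _ => -1) := by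
      simp [laurentOf, AddMonoidAlgebra.one_def, ← Prod.zero_eq_mk]
    have hkernel : (1 - X + X * Y : Laurent₂) = kernelOf 1 := by
      unfold kernelOf
      ring
    rw [← alpha_eq_weightedCount, ← prodOperator_gtProduct_eq_alpha, hkernel, hone]
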